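/- Let $I=[0,1]$, let $K\subset[0,1]$ be the middle third Cantor set, and for a finite binary string $a$ let $K_a$ be the corresponding similar copy of $K$ (so $K_\emptyset=K$, $K_{0a}=\tfrac13K_a$, $K_{1a}=\tfrac13K_a+\tfrac23$). Let $\sim$ be the equivalence relation on $I\times K$ generated by the following identifications: for every $n\ge1$, every $t=\sum_{i=1}^n m_i3^{-i}$ with $m_i\in\{0,1,2\}$ and $m_n>0$, and every binary string $a$ of length $n-1$, each point $(t,u)$ with $u\in K_{a0}$ is identified with $(t,u+2/3^n)$. Let $F=(I\times K)/\!\sim$ (Laakso space), with quotient map $q\colon I\times K\to F$, height $h\colon F\to I$, $h(q(x_1,x_2))=x_1$, and metric $$d(x,y)=\inf\{\mathcal H^1(p): p\subset I\times K,\ q(p)\text{ is a path joining }x\text{ and }y\},$$ where $\mathcal H^1$ is taken with respect to the Euclidean distance of the plane and a path joining $x$ and $y$ is the image of a curve from $x$ to $y$ that is continuous for the quotient topology. For $w\in(0,1)$ let $\nu_w$ be the image of the infinite product measure $\prod_{i\ge1}\bigl(w\,\delta_0+(1-w)\,\delta_1\bigr)$ on $\{0,1\}^{\mathbb N}$ under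 $(a_i)_{i\ge1}\mapsto\sum_{i\ge1}2a_i3^{-i}\in K$, and let $\mu_w=q_*(\mathcal H^1\times\nu_w)$, a Borel measure on $(F,d)$. **Theorem 1.1.** (0) For each $w\in(0,1)$ the measure $\mu_w$ is doubling on $(F,d)$: all balls have positive finite measure and there is a constant $D>1$ such that $\mu_w(B(x,2r))\le D\,\mu_w(B(x,r))$ for all $x\in F$ and $r>0$. (1) $\mu_w$ and $\mu_{w'}$ are mutually singular for all $w\ne w'$ in $(0,1)$. (2) For each $w\in(0,1)$, every Lipschitz map $f\colon F\to\mathbb R$ is differentiable at $\mu_w$-almost every $x\in F$ with respect to $h$, that is, there exists $Df(x)\in\mathbb R$ with $$\lim_{y\to x}\frac{f(y)-f(x)-Df(x)\,(h(y)-h(x))}{d(y,x)}=0 .$$ -/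

import Mathlib

open Set Filter Topology MeasureTheory
open scoped ENNReal NNReal

noncomputable section

namespace Laakso

/-! ### The Cantor set, its similar copies, and the Laakso space as a set -/

/-- The two similarities `x ↦ x / 3` (left, `false`) and `x ↦ x / 3 + 2 / 3` (right, `true`)
generating the middle third Cantor set. -/
def similarity (b : Bool) (x : ℝ) : ℝ := if b then x / 3 + 2 / 3 else x / 3

/-- The similar copy `K_a` of the Cantor set `K` for a binary string `a`
(`false` stands for the digit `0`, `true` for the digit `1`):
`K_∅ = K` and `K_{ba}` is the image of `K_a` under the similarity with index `b`. -/
def cantorCopy : List Bool → Set ℝ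
  | [] => cantorSet
  | b :: a => similarity b '' cantorCopy a

/-- The product `I × K`. -/
abbrev Strip : Type := unitInterval × cantorSet

/-- The heights `∑_{i=1}^{n+1} m_i / 3^i`, with `m_i ∈ {0,1,2}` and `m_{n+1} > 0`,
of the wormhole levels of order `n + 1`. -/
def wormholeHeights (n : ℕ) : Set ℝ :=
  {t | ∃ m : Fin (n + 1) → Fin 3, 0 < m (Fin.last n) ∧
    t = ∑ i : Fin (n + 1), ((m i : ℕ) : ℝ) / 3 ^ ((i : ℕ) + 1)}

/-- The identifications: at a wormhole level `t` of order `n + 1`, for a binary string `a` of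
length `n`, a point `(t, u)` with `u ∈ K_{a0}` is identified with `(t, u + 2 / 3 ^ (n + 1))`. -/
inductive Glued : Strip → Strip → Prop
  | intro (n : ℕ) (a : List Bool) (t : unitInterval) (u v : cantorSet)
      (ha : a.length = n) (ht : (t : ℝ) ∈ wormholeHeights n)
      (hu : (u : ℝ) ∈ cantorCopy (a ++ [false]))
      (hv : (v : ℝ) = (u : ℝ) + 2 / 3 ^ (n + 1)) : Glued (t, u) (t, v)

/-- The equivalence relation generated by the identifications. -/
def gluingSetoid : Setoid Strip := Relation.EqvGen.setoid Glued

/-- The quotient `(I × K) / ∼`, with the quotient topology. -/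
abbrev Gluing : Type := Quotient gluingSetoid

/-- The quotient map onto the quotient. -/
def mk (z : Strip) : Gluing := Quotient.mk gluingSetoid z

theorem fst_eq_of_rel {z z' : Strip} (h : gluingSetoid z z') : z.1 = z'.1 := by
  have h' : Relation.EqvGen Glued z z' := h
  clear h
  induction h' with
  | rel _ _ h => cases h; rfl
  | refl => rfl
  | symm _ _ _ ih => exact ih.symm
  | trans _ _ _ _ _ ih1 ih2 => exact ih1.trans ih2

/-- The height `h[x₁, x₂] = x₁`, on the quotient. -/
def gluingHeight : Gluing → ℝ :=
  Quotient.lift (fun z : Strip => (z.1 : ℝ)) (fun _ _ h => congrArg _ (fst_eq_of_rel h))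

/-! ### The distance -/

/-- The inclusion of `I × K` in the Euclidean plane. -/
def toPlane (z : Strip) : EuclideanSpace ℝ (Fin 2) := !₂[(z.1 : ℝ), (z.2 : ℝ)]

/-- One-dimensional Hausdorff measure of a subset of `I × K`, for the Euclidean distance. -/
def length (p : Set Strip) : ℝ≥0∞ := Measure.hausdorffMeasure 1 (toPlane '' p)

/-- `A` is a path joining `x` and `y`: the image of a continuous curve from `x` to `y`. -/
def IsPathJoining (A : Set Gluing) (x y : Gluing) : Prop :=
  ∃ γ : Path x y, range γ = A

/-- `d(x, y) = inf {H¹(p) : p ⊆ I × K, q(p) is a path joining x and y}`. -/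
def pathEDist (x y : Gluing) : ℝ≥0∞ :=
  ⨅ (p : Set Strip) (_ : IsPathJoining (mk '' p) x y), length p

/-! ### `pathEDist` is a finite metric -/

theorem continuous_mk : Continuous mk := continuous_quotient_mk'

theorem continuous_gluingHeight : Continuous gluingHeight :=
  Continuous.quotient_lift (by fun_prop) _

theorem exists_mk (x : Gluing) : ∃ z, mk z = x := Quotient.exists_rep x

theorem length_singleton (z : Strip) : length {z} = 0 := by
  have := Measure.nullSingletonClass_hausdorff (X := EuclideanSpace ℝ (Fin 2)) zero_lt_one
  rw [length, image_singleton, measure_singleton]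

theorem pathEDist_self (x : Gluing) : pathEDist x x = 0 := by
  obtain ⟨z, rfl⟩ := exists_mk x
  refine le_antisymm (iInf₂_le_of_le {z} ⟨Path.refl _, by simp⟩ ?_) bot_le
  exact (length_singleton z).le

theorem pathEDist_le_symm (x y : Gluing) : pathEDist x y ≤ pathEDist y x := by
  refine le_iInf₂ fun p hp => iInf₂_le p ?_
  obtain ⟨γ, hγ⟩ := hp
  exact ⟨γ.symm, by rw [Path.symm_range, hγ]⟩

theorem pathEDist_triangle (x y z : Gluing) :
    pathEDist x z ≤ pathEDist x y + pathEDist y z := by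
  unfold pathEDist
  simp only [ENNReal.iInf_add, ENNReal.add_iInf]
  refine le_iInf fun p' => le_iInf fun hp' => le_iInf fun p => le_iInf fun hp => ?_
  obtain ⟨γ, hγ⟩ := hp
  obtain ⟨γ', hγ'⟩ := hp'
  refine iInf₂_le_of_le (p ∪ p') ⟨γ.trans γ', ?_⟩ ?_
  · rw [Path.trans_range, hγ, hγ', image_union]
  · unfold length
    rw [image_union]
    exact measure_union_le _ _

theorem length_ge {x y : Gluing} (γ : Path x y) (p : Set Strip) (hγ : range γ = mk '' p)
    (s : unitInterval) :
    ENNReal.ofReal |gluingHeight (γ s) - gluingHeight x| ≤ length p := by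
  have hpre : IsPreconnected (gluingHeight '' range γ) :=
    ((isPreconnected_range γ.continuous).image _ continuous_gluingHeight.continuousOn)
  have hsub : uIcc (gluingHeight x) (gluingHeight (γ s)) ⊆ gluingHeight '' range γ :=
    hpre.ordConnected.uIcc_subset ⟨γ 0, mem_range_self _, by simp⟩ ⟨γ s, mem_range_self _, rfl⟩
  have himg : gluingHeight '' range γ =
      (fun v : EuclideanSpace ℝ (Fin 2) => v 0) '' (toPlane '' p) := by
    rw [hγ, image_image, image_image]
    rfl
  have hlip : LipschitzWith 1 (fun v : EuclideanSpace ℝ (Fin 2) => v 0) := by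
    refine LipschitzWith.of_dist_le_mul fun v w => ?_
    have := PiLp.norm_apply_le (v - w) 0
    simpa [dist_eq_norm] using this
  calc ENNReal.ofReal |gluingHeight (γ s) - gluingHeight x|
      = volume (uIcc (gluingHeight x) (gluingHeight (γ s))) := by rw [Real.volume_interval]
    _ ≤ volume ((fun v : EuclideanSpace ℝ (Fin 2) => v 0) '' (toPlane '' p)) :=
        measure_mono (hsub.trans himg.le)
    _ ≤ length p := by
        rw [← hausdorffMeasure_real]
        simpa [length] using hlip.hausdorffMeasure_image_le zero_le_one (toPlane '' p)

/-- The point of the Cantor set with given binary address. -/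
abbrev pt (s : ℕ → Bool) : cantorSet := cantorSetHomeomorphNatToBool.symm s

/-- The binary address of a point of the Cantor set. -/
abbrev addr (u : cantorSet) : ℕ → Bool := cantorSetHomeomorphNatToBool u

theorem coe_pt (s : ℕ → Bool) :
    (pt s : ℝ) = Real.ofDigits (fun i => cond (s i) (2 : Fin 3) 0) := rfl

theorem coe_pt_shift (s : ℕ → Bool) :
    (pt s : ℝ) = similarity (s 0) (pt (fun i => s (i + 1))) := by
  rw [coe_pt, coe_pt, Real.ofDigits_eq_sum_add_ofDigits _ 1]
  simp only [similarity, Finset.range_one, Finset.sum_singleton, Real.ofDigitsTerm]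
  cases s 0 <;> simp <;> ring

theorem mem_cantorCopy_iff (a : List Bool) (s : ℕ → Bool) :
    (pt s : ℝ) ∈ cantorCopy a ↔ ∀ i (h : i < a.length), s i = a[i] := by
  induction a generalizing s with
  | nil => simp [cantorCopy]
  | cons b a ih =>
    have hrange : ∀ x ∈ cantorCopy a, ∃ s', x = (pt s' : ℝ) := by
      intro x hx
      have : x ∈ cantorSet := by
        clear ih
        induction a generalizing x with
        | nil => exact hx
        | cons b a ih =>
          obtain ⟨y, hy, rfl⟩ := hx
          have := ih y hy
          rw [cantorSet_eq_union_halves]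
          cases b
          · exact Or.inl ⟨y, this, by simp [similarity]⟩
          · exact Or.inr ⟨y, this, by simp [similarity]; ring⟩
      exact ⟨addr ⟨x, this⟩, by simp⟩
    have hcons : ∀ (b : Bool) (s' : ℕ → Bool),
        similarity b (pt s') = (pt (fun i => Nat.casesOn i b s') : ℝ) := by
      intro b s'
      rw [coe_pt_shift (fun i => Nat.casesOn i b s')]
      rfl
    constructor
    · rintro ⟨x, hx, hxs⟩
      obtain ⟨s', rfl⟩ := hrange x hx
      rw [hcons] at hxs
      have h := cantorSetHomeomorphNatToBool.symm.injective (Subtype.ext hxs)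
      rw [ih] at hx
      intro i hi
      rw [← h]
      cases i with
      | zero => rfl
      | succ i => exact hx i (by simpa using hi)
    · intro h
      refine ⟨pt (fun i => s (i + 1)), (ih _).2 fun i hi => ?_, ?_⟩
      · exact h (i + 1) (by simpa using hi)
      · rw [coe_pt_shift s, h 0 (by simp)]
        rfl

theorem pt_update (s : ℕ → Bool) (n : ℕ) (h : s n = false) :
    (pt (Function.update s n true) : ℝ) = pt s + 2 / 3 ^ (n + 1) := by
  rw [coe_pt, coe_pt]
  unfold Real.ofDigits
  have hs := Real.summable_ofDigitsTerm (digits := fun i => cond (s i) (2 : Fin 3) 0)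
  have h1 := hs.hasSum.add (hasSum_ite_eq n ((2 : ℝ) / 3 ^ (n + 1)))
  rw [← h1.tsum_eq]
  congr 1
  ext i
  simp only [Real.ofDigitsTerm]
  by_cases hi : i = n
  · subst hi
    simp [h]
    ring
  · simp [hi]

theorem glued_iff (z z' : Strip) : Glued z z' ↔ z.1 = z'.1 ∧ ∃ n, (z.1 : ℝ) ∈ wormholeHeights n ∧
    addr z.2 n = false ∧ addr z'.2 = Function.update (addr z.2) n true := by
  constructor
  · rintro ⟨n, a, t, u, v, ha, ht, hu, hv⟩
    refine ⟨rfl, n, ht, ?_⟩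
    obtain ⟨s, rfl⟩ := cantorSetHomeomorphNatToBool.symm.surjective u
    rw [mem_cantorCopy_iff] at hu
    have hsn : s n = false := by
      have := hu n (by simp [ha])
      simpa [← ha] using this
    have : v = pt (Function.update s n true) := Subtype.ext (by rw [hv, pt_update s n hsn])
    simp [this, hsn]
  · obtain ⟨t, u⟩ := z
    obtain ⟨t', v⟩ := z'
    rintro ⟨h, n, ht, hn, h'⟩
    obtain rfl : t = t' := h
    obtain ⟨s, rfl⟩ := cantorSetHomeomorphNatToBool.symm.surjective u
    obtain ⟨s', rfl⟩ := cantorSetHomeomorphNatToBool.symm.surjective v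
    simp only [Homeomorph.apply_symm_apply] at hn h'
    refine ⟨n, List.ofFn (fun i : Fin n => s i), t, _, _, by simp, ht, ?_, ?_⟩
    · rw [mem_cantorCopy_iff]
      intro i hi
      by_cases hin : i < n
      · simp [hin]
      · have : i = n := by simp at hi; omega
        subst this
        simp [hn]
    · rw [h']
      exact pt_update s n hn

/-- Addresses that agree off the order of a wormhole level give the same point of the quotient. -/
theorem mk_eq_of_eqOn {t : unitInterval} {n : ℕ} (ht : (t : ℝ) ∈ wormholeHeights n)
    {s s' : ℕ → Bool} (h : ∀ k, k ≠ n → s k = s' k) : mk (t, pt s) = mk (t, pt s') := by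
  have key : ∀ s s' : ℕ → Bool, (∀ k, k ≠ n → s k = s' k) → s n = false → s' n = true →
      mk (t, pt s) = mk (t, pt s') := by
    intro s s' h h1 h2
    refine Quotient.sound (Relation.EqvGen.rel _ _ ((glued_iff _ _).2 ⟨rfl, n, ht, ?_, ?_⟩))
    · simpa using h1
    · simp only [Homeomorph.apply_symm_apply]
      ext k
      by_cases hk : k = n
      · subst hk; simp [h2]
      · simp [Function.update_of_ne hk, h k hk]
  cases h1 : s n <;> cases h2 : s' n
  · rw [show s = s' from funext fun k => by by_cases hk : k = n <;> grind]
  · exact key s s' h h1 h2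
  · exact (key s' s (fun k hk => (h k hk).symm) h2 h1).symm
  · rw [show s = s' from funext fun k => by by_cases hk : k = n <;> grind]

theorem wormholeHeights_finite (n : ℕ) : (wormholeHeights n).Finite := by
  refine (Set.finite_range (fun m : Fin (n + 1) → Fin 3 =>
    ∑ i : Fin (n + 1), ((m i : ℕ) : ℝ) / 3 ^ ((i : ℕ) + 1))).subset ?_
  rintro t ⟨m, -, rfl⟩
  exact ⟨m, rfl⟩

theorem inv_pow_mem_wormholeHeights (n : ℕ) : ((3 : ℝ)⁻¹) ^ (n + 1) ∈ wormholeHeights n := by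
  refine ⟨Pi.single (Fin.last n) 1, by simp, ?_⟩
  rw [Finset.sum_eq_single (Fin.last n)]
  · simp
  · intro i _ hi
    simp [Pi.single_eq_of_ne hi]
  · simp

theorem exists_int_of_mem {n : ℕ} {t : ℝ} (ht : t ∈ wormholeHeights n) :
    ∃ N : ℤ, t * 3 ^ (n + 1) = N ∧ ¬ (3 : ℤ) ∣ N := by
  obtain ⟨m, hm, rfl⟩ := ht
  refine ⟨(∑ i : Fin n, (m i.castSucc : ℤ) * 3 ^ (n - i)) + (m (Fin.last n) : ℤ), ?_, ?_⟩
  · rw [Fin.sum_univ_castSucc, add_mul, Finset.sum_mul]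
    push_cast
    congr 1
    · refine Finset.sum_congr rfl fun i _ => ?_
      have : (3 : ℝ) ^ (n + 1) = 3 ^ (n - (i : ℕ)) * 3 ^ ((i : ℕ) + 1) := by
        rw [← pow_add]
        congr 1
        omega
      rw [this, Fin.val_castSucc]
      field_simp
    · simp
  · have h1 : (3 : ℤ) ∣ ∑ i : Fin n, (m i.castSucc : ℤ) * 3 ^ (n - i) :=
      Finset.dvd_sum fun i _ => Dvd.dvd.mul_left (dvd_pow_self _ (by omega)) _
    rw [dvd_add_right h1]
    have : (m (Fin.last n) : ℕ) < 3 := (m (Fin.last n)).2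
    have : 0 < (m (Fin.last n) : ℕ) := hm
    omega

theorem order_unique {n k : ℕ} {t : ℝ} (hn : t ∈ wormholeHeights n)
    (hk : t ∈ wormholeHeights k) : n = k := by
  have key : ∀ n k : ℕ, t ∈ wormholeHeights n → t ∈ wormholeHeights k → ¬ n < k := by
    intro n k hn hk hlt
    obtain ⟨N, hN, -⟩ := exists_int_of_mem hn
    obtain ⟨M, hM, hM3⟩ := exists_int_of_mem hk
    refine hM3 ⟨N * 3 ^ (k - n - 1), ?_⟩
    have : k + 1 = (n + 1) + ((k - n - 1) + 1) := by omega
    rw [this, pow_add, ← mul_assoc, hN] at hM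
    rify
    rw [← hM]
    ring
  have h1 := key n k hn hk
  have h2 := key k n hk hn
  omega

/-- The `n`-th binary digit, weighted by the distance of the height to the wormhole levels of
order `n + 1`. -/
def weightedDigit (n : ℕ) : Gluing → ℝ :=
  Quotient.lift (fun z : Strip => Metric.infDist (z.1 : ℝ) (wormholeHeights n) *
    (if addr z.2 n then 1 else 0)) (by
    intro z z' h
    have h' : Relation.EqvGen Glued z z' := h
    clear h
    induction h' with
    | rel z z' h =>
      obtain ⟨h1, k, hk, -, h2⟩ := (glued_iff _ _).1 h
      by_cases hkn : n = k
      · subst hkn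
        rw [← h1, Metric.infDist_zero_of_mem hk, zero_mul, zero_mul]
      · rw [h2, h1, Function.update_of_ne hkn]
    | refl => rfl
    | symm _ _ _ ih => exact ih.symm
    | trans _ _ _ _ _ ih1 ih2 => exact ih1.trans ih2)

theorem weightedDigit_mk (n : ℕ) (z : Strip) : weightedDigit n (mk z) =
    Metric.infDist (z.1 : ℝ) (wormholeHeights n) * (if addr z.2 n then 1 else 0) := rfl

theorem continuous_weightedDigit (n : ℕ) : Continuous (weightedDigit n) := by
  refine Continuous.quotient_lift (Continuous.mul ?_ ?_) _
  · exact (Metric.continuous_infDist_pt _).comp (by fun_prop)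
  · have h1 : Continuous (fun b : Bool => if b then (1 : ℝ) else 0) := continuous_of_discreteTopology
    exact h1.comp ((continuous_apply n).comp
      (cantorSetHomeomorphNatToBool.continuous.comp continuous_snd))

/-- A path between points whose `n`-th digits differ meets a wormhole level of order `n + 1`. -/
theorem exists_height_mem {n : ℕ} {z z' : Strip} (γ : Path (mk z) (mk z'))
    (h1 : addr z.2 n = false) (h2 : addr z'.2 n = true) :
    ∃ s, gluingHeight (γ s) ∈ wormholeHeights n := by
  let φ : Gluing → ℝ := fun x => weightedDigit n x -
    Metric.infDist (gluingHeight x) (wormholeHeights n) / 2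
  have hφ : Continuous φ := (continuous_weightedDigit n).sub
    (((Metric.continuous_infDist_pt _).comp continuous_gluingHeight).div_const 2)
  have hpre := (isPreconnected_range (f := fun s => φ (γ s)) (hφ.comp γ.continuous)).ordConnected
  have ha : φ (γ 0) ≤ 0 := by
    have h0 : (0 : ℝ) ≤ Metric.infDist (z.1 : ℝ) (wormholeHeights n) := Metric.infDist_nonneg
    simp only [φ, Path.source, weightedDigit_mk, h1]
    have : gluingHeight (mk z) = z.1 := rfl
    rw [this]
    simp only [Bool.false_eq_true, if_false, mul_zero]
    linarith
  have hb : 0 ≤ φ (γ 1) := by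
    have h0 : (0 : ℝ) ≤ Metric.infDist (z'.1 : ℝ) (wormholeHeights n) := Metric.infDist_nonneg
    simp only [φ, Path.target, weightedDigit_mk, h2]
    have : gluingHeight (mk z') = z'.1 := rfl
    rw [this]
    simp only [if_true, mul_one]
    linarith
  obtain ⟨s, hs⟩ := hpre.out (mem_range_self 0) (mem_range_self 1) ⟨ha, hb⟩
  refine ⟨s, ?_⟩
  obtain ⟨y, hy⟩ := exists_mk (γ s)
  have hzero : Metric.infDist (gluingHeight (γ s)) (wormholeHeights n) = 0 := by
    have hh : gluingHeight (mk y) = y.1 := rfl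
    simp only [φ] at hs
    rw [← hy, weightedDigit_mk, hh] at hs
    rw [← hy, hh]
    split_ifs at hs <;> linarith
  rwa [(wormholeHeights_finite n).isClosed.mem_iff_infDist_zero
    ⟨_, inv_pow_mem_wormholeHeights n⟩]

theorem eq_of_pathEDist_eq_zero {x y : Gluing} (h : pathEDist x y = 0) : x = y := by
  obtain ⟨⟨t, u⟩, rfl⟩ := exists_mk x
  obtain ⟨⟨t', v⟩, rfl⟩ := exists_mk y
  have hsmall : ∀ ε : ℝ, 0 < ε → ∃ γ : Path (mk (t, u)) (mk (t', v)),
      ∀ s, |gluingHeight (γ s) - t| < ε := by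
    intro ε hε
    have : pathEDist (mk (t, u)) (mk (t', v)) < ENNReal.ofReal ε := by
      rw [h]; exact ENNReal.ofReal_pos.2 hε
    simp only [pathEDist, iInf_lt_iff] at this
    obtain ⟨p, ⟨γ, hγ⟩, hp⟩ := this
    refine ⟨γ, fun s => ?_⟩
    have := (length_ge γ p hγ s).trans_lt hp
    exact (ENNReal.ofReal_lt_ofReal_iff hε).1 this
  have htt : t = t' := by
    by_contra hne
    have : (0 : ℝ) < |(t' : ℝ) - t| := abs_pos.2 (sub_ne_zero.2 fun h => hne (Subtype.ext h.symm))
    obtain ⟨γ, hγ⟩ := hsmall _ this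
    have := hγ 1
    rw [Path.target] at this
    exact lt_irrefl _ this
  subst htt
  have hdig : ∀ n, addr u n ≠ addr v n → (t : ℝ) ∈ wormholeHeights n := by
    intro n hn
    by_contra ht
    have hpos := ((wormholeHeights_finite n).isClosed.notMem_iff_infDist_pos
      ⟨_, inv_pow_mem_wormholeHeights n⟩).1 ht
    obtain ⟨γ, hγ⟩ := hsmall _ hpos
    have : ∃ s, gluingHeight (γ s) ∈ wormholeHeights n := by
      cases hu : addr u n <;> cases hv : addr v n
      · exact absurd (hu.trans hv.symm) hn
      · exact exists_height_mem γ hu hv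
      · obtain ⟨s, hs⟩ := exists_height_mem γ.symm hv hu
        exact ⟨_, hs⟩
      · exact absurd (hu.trans hv.symm) hn
    obtain ⟨s, hs⟩ := this
    have h1 := Metric.infDist_le_dist_of_mem (x := (t : ℝ)) hs
    have h2 := hγ s
    rw [← Real.dist_eq, dist_comm] at h2
    linarith
  by_cases hex : ∃ n, addr u n ≠ addr v n
  · obtain ⟨n, hn⟩ := hex
    have := mk_eq_of_eqOn (hdig n hn) (s := addr u) (s' := addr v) (fun k hk => by
      by_contra hne
      exact hk (order_unique (hdig k hne) (hdig n hn)))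
    simpa using this
  · push Not at hex
    rw [cantorSetHomeomorphNatToBool.injective (funext hex)]

theorem length_le_of_subset (p : Set Strip) (u : cantorSet) (a b : ℝ)
    (hp : ∀ z ∈ p, z.2 = u ∧ a ≤ z.1 ∧ (z.1 : ℝ) ≤ b) : length p ≤ ENNReal.ofReal (b - a) := by
  have hiso : Isometry (fun r : ℝ => (!₂[r, (u : ℝ)] : EuclideanSpace ℝ (Fin 2))) := by
    refine Isometry.of_dist_eq fun r r' => ?_
    simp [EuclideanSpace.dist_eq, Real.sqrt_sq_eq_abs, Real.dist_eq]
  calc length p ≤ Measure.hausdorffMeasure 1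
        ((fun r : ℝ => (!₂[r, (u : ℝ)] : EuclideanSpace ℝ (Fin 2))) '' Icc a b) := by
        refine measure_mono ?_
        rintro _ ⟨z, hz, rfl⟩
        obtain ⟨h1, h2, h3⟩ := hp z hz
        exact ⟨z.1, ⟨h2, h3⟩, by simp [toPlane, h1]⟩
    _ = ENNReal.ofReal (b - a) := by
        rw [hiso.hausdorffMeasure_image (Or.inl zero_le_one), hausdorffMeasure_real,
          Real.volume_Icc]

theorem pathEDist_vertical (t t' : unitInterval) (u : cantorSet) :
    pathEDist (mk (t, u)) (mk (t', u)) < ⊤ := by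
  have hpc : PathConnectedSpace unitInterval := isPathConnected_iff_pathConnectedSpace.1
    ((convex_Icc (0 : ℝ) 1).isPathConnected ⟨0, by simp⟩)
  obtain ⟨γ⟩ : Nonempty (Path t t') := hpc.joined t t'
  refine (iInf₂_le (range fun s => (γ s, u)) ?_).trans_lt
    ((length_le_of_subset _ u 0 1 ?_).trans_lt ENNReal.ofReal_lt_top)
  · refine ⟨γ.map (f := fun t => mk (t, u)) (continuous_mk.comp (by fun_prop)), ?_⟩
    rw [← range_comp]
    rfl
  · rintro _ ⟨s, rfl⟩
    exact ⟨rfl, (γ s).2.1, (γ s).2.2⟩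

/-- Joining the bottom point over `pt s` to the top point over `pt s'`, by changing the `n`-th
digit at the height `3⁻¹ ^ (n + 1)`. -/
theorem pathEDist_zigzag (s s' : ℕ → Bool) :
    pathEDist (mk (0, pt s)) (mk (1, pt s')) < ⊤ := by
  let Zm : unitInterval → ℕ → Bool := fun r n => if (3 : ℝ)⁻¹ ^ (n + 1) < r then s' n else s n
  let Zp : unitInterval → ℕ → Bool := fun r n => if (3 : ℝ)⁻¹ ^ (n + 1) ≤ r then s' n else s n
  have hZ : ∀ r, mk (r, pt (Zm r)) = mk (r, pt (Zp r)) := by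
    intro r
    by_cases hex : ∃ n : ℕ, (3 : ℝ)⁻¹ ^ (n + 1) = r
    · obtain ⟨n, hn⟩ := hex
      refine mk_eq_of_eqOn (n := n) (hn ▸ inv_pow_mem_wormholeHeights n) fun k hk => ?_
      have : (3 : ℝ)⁻¹ ^ (k + 1) ≠ r := by
        intro h
        exact hk (order_unique (inv_pow_mem_wormholeHeights k)
          (h.trans hn.symm ▸ inv_pow_mem_wormholeHeights n))
      simp only [Zm, Zp, lt_iff_le_and_ne, this, ne_eq, not_false_eq_true, and_true]
    · push Not at hex
      congr 3
      ext k
      simp only [Zm, Zp, lt_iff_le_and_ne, hex k, ne_eq, not_false_eq_true, and_true]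
  have hlow : ∀ (c : ℝ) (b b' : Bool) (r : unitInterval),
      ContinuousWithinAt (fun r : unitInterval => if c < r then b' else b) (Iic r) r := by
    intro c b b' r
    by_cases h : c < r
    · have : ∀ᶠ x : unitInterval in 𝓝 r, c < x :=
        continuous_subtype_val.continuousAt.eventually (lt_mem_nhds h)
      refine (continuousAt_const (y := b') |>.congr ?_).continuousWithinAt
      filter_upwards [this] with x hx
      simp [hx]
    · refine (continuousWithinAt_const (b := b)).congr (fun x hx => ?_) (by simp [h])
      have : ¬ c < x := fun h' => h (h'.trans_le hx)
      simp [this]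
  have hup : ∀ (c : ℝ) (b b' : Bool) (r : unitInterval),
      ContinuousWithinAt (fun r : unitInterval => if c ≤ r then b' else b) (Ici r) r := by
    intro c b b' r
    by_cases h : c ≤ r
    · refine (continuousWithinAt_const (b := b')).congr (fun x hx => ?_) (by simp [h])
      have : c ≤ x := h.trans hx
      simp [this]
    · have : ∀ᶠ x : unitInterval in 𝓝 r, (x : ℝ) < c :=
        continuous_subtype_val.continuousAt.eventually (gt_mem_nhds (not_le.1 h))
      refine (continuousAt_const (y := b) |>.congr ?_).continuousWithinAt
      filter_upwards [this] with x hx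
      simp [not_le.2 hx]
  have hcomp : ∀ (Z : unitInterval → ℕ → Bool) (A : Set unitInterval) (r : unitInterval),
      ContinuousWithinAt Z A r → ContinuousWithinAt (fun r => mk (r, pt (Z r))) A r := by
    intro Z A r h
    refine continuous_mk.continuousAt.comp_continuousWithinAt
      (continuousWithinAt_id.prodMk ?_)
    exact cantorSetHomeomorphNatToBool.symm.continuous.continuousAt.comp_continuousWithinAt h
  have hcont : Continuous (fun r => mk (r, pt (Zm r))) := by
    refine continuous_iff_continuousAt.2 fun r => continuousAt_iff_continuous_left_right.2 ⟨?_, ?_⟩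
    · exact hcomp Zm _ r (continuousWithinAt_pi.2 fun n => hlow _ _ _ _)
    · rw [funext hZ]
      exact hcomp Zp _ r (continuousWithinAt_pi.2 fun n => hup _ _ _ _)
  let γ : Path (mk (0, pt s)) (mk (1, pt s')) :=
    { toFun := fun r => mk (r, pt (Zm r))
      continuous_toFun := hcont
      source' := by
        have : Zm 0 = s := by
          ext n
          have : ¬ (3 : ℝ)⁻¹ ^ (n + 1) < 0 := not_lt.2 (by positivity)
          simp only [Zm, Set.Icc.coe_zero, this, if_false]
        rw [this]
      target' := by
        have : Zm 1 = s' := by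
          ext n
          have : (3 : ℝ)⁻¹ ^ (n + 1) < 1 := pow_lt_one₀ (by norm_num) (by norm_num) (by omega)
          simp only [Zm, Set.Icc.coe_one, this, if_true]
        rw [this] }
  refine (iInf₂_le (range fun r => (r, pt (Zm r)))
    ⟨γ, range_comp mk fun r => (r, pt (Zm r))⟩).trans_lt ?_
  let w : ℕ → cantorSet := fun n => pt fun k => if n ≤ k then s' k else s k
  let P : ℕ → Set Strip := fun n => {z | z.2 = w n ∧ 0 ≤ (z.1 : ℝ) ∧ (z.1 : ℝ) ≤ (3 : ℝ)⁻¹ ^ n}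
  have hsub : (range fun r => (r, pt (Zm r))) ⊆ {((0 : unitInterval), pt (Zm 0))} ∪ ⋃ n, P n := by
    rintro _ ⟨r, rfl⟩
    by_cases hr : r = 0
    · left; rw [hr]; rfl
    right
    have hr0 : (0 : ℝ) < r := lt_of_le_of_ne r.2.1 fun h => hr (Subtype.ext h.symm)
    obtain ⟨n, hn1, hn2⟩ := exists_nat_pow_near_of_lt_one hr0 r.2.2
      (by norm_num : (0 : ℝ) < 3⁻¹) (by norm_num)
    refine mem_iUnion.2 ⟨n, ?_, hr0.le, hn2⟩
    simp only [w]
    congr 1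
    ext k
    simp only [Zm]
    by_cases hk : n ≤ k
    · have : (3 : ℝ)⁻¹ ^ (k + 1) < r :=
        (pow_le_pow_of_le_one (by norm_num) (by norm_num) (by omega)).trans_lt hn1
      simp only [this, hk, if_true]
    · have : ¬ (3 : ℝ)⁻¹ ^ (k + 1) < r := not_lt.2
        (hn2.trans (pow_le_pow_of_le_one (by norm_num) (by norm_num) (by omega)))
      simp only [this, hk, if_false]
  have hsum : (∑' n : ℕ, ENNReal.ofReal ((3 : ℝ)⁻¹ ^ n)) < ⊤ :=
    (summable_geometric_of_lt_one (by norm_num) (by norm_num)).tsum_ofReal_lt_top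
  calc length (range fun r => (r, pt (Zm r)))
      ≤ length ({((0 : unitInterval), pt (Zm 0))} ∪ ⋃ n, P n) :=
        measure_mono (image_mono hsub)
    _ ≤ length {((0 : unitInterval), pt (Zm 0))} + ∑' n, length (P n) := by
        unfold length
        rw [image_union, image_iUnion]
        exact (measure_union_le _ _).trans (add_le_add le_rfl (measure_iUnion_le _))
    _ ≤ 0 + ∑' n : ℕ, ENNReal.ofReal ((3 : ℝ)⁻¹ ^ n) := by
        refine add_le_add (length_singleton _).le (ENNReal.tsum_le_tsum fun n => ?_)
        simpa using length_le_of_subset (P n) (w n) 0 _ (fun z hz => hz)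
    _ < ⊤ := by simpa using hsum

theorem pathEDist_lt_top (x y : Gluing) : pathEDist x y < ⊤ := by
  obtain ⟨⟨t, u⟩, rfl⟩ := exists_mk x
  obtain ⟨⟨t', v⟩, rfl⟩ := exists_mk y
  have h := pathEDist_zigzag (addr u) (addr v)
  simp only [Homeomorph.symm_apply_apply] at h
  refine (pathEDist_triangle _ (mk (0, u)) _).trans_lt (ENNReal.add_lt_top.2
    ⟨pathEDist_vertical _ _ _, ?_⟩)
  exact (pathEDist_triangle _ (mk (1, v)) _).trans_lt (ENNReal.add_lt_top.2
    ⟨h, pathEDist_vertical _ _ _⟩)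

/-! ### The Laakso space as a metric measurable space -/

/-- The Laakso space `F`: the set `(I × K) / ∼`, to be equipped with the metric `d`. -/
def Space : Type := Gluing

/-- The extended metric on `F` given by `d`. -/
@[reducible] def emetricSpace : EMetricSpace Space where
  edist := pathEDist
  edist_self := pathEDist_self
  edist_comm x y := le_antisymm (pathEDist_le_symm x y) (pathEDist_le_symm y x)
  edist_triangle := pathEDist_triangle
  eq_of_edist_eq_zero h := eq_of_pathEDist_eq_zero h

/-- The metric `d` on `F`; its values are the (finite) values of `pathEDist`. -/
instance : MetricSpace Space :=
  @EMetricSpace.toMetricSpace Space emetricSpace fun x y => (pathEDist_lt_top x y).ne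

/-- `F` carries the Borel `σ`-algebra of the metric `d`. -/
instance : MeasurableSpace Space := borel Space

instance : BorelSpace Space := ⟨rfl⟩

/-- The quotient map `q : I × K → F`. -/
def q (z : Strip) : Space := mk z

/-- The height chart `h : F → I`, `h[x₁, x₂] = x₁`, with values considered in `ℝ`. -/
def height (x : Space) : ℝ := gluingHeight x

/-- Differentiability of `f` at `x` with respect to the chart `h`. -/
def DifferentiableAtPoint (f : Space → ℝ) (x : Space) : Prop :=
  ∃ D : ℝ, Tendsto (fun y => (f y - f x - D * (height y - height x)) / dist y x) (𝓝[≠] x) (𝓝 0)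

/-! ### The measures -/

/-- The measure on `{0, 1}` giving mass `w` to `0` and `1 - w` to `1`. -/
def digitMeasure (w : Ioo (0 : ℝ) 1) : Measure Bool :=
  ENNReal.ofReal w • Measure.dirac false + ENNReal.ofReal (1 - w) • Measure.dirac true

instance (w : Ioo (0 : ℝ) 1) : IsProbabilityMeasure (digitMeasure w) := by
  constructor
  simp only [digitMeasure, Measure.coe_add, Measure.coe_smul, Pi.add_apply, Pi.smul_apply,
    measure_univ, smul_eq_mul, mul_one]
  rw [← ENNReal.ofReal_add w.2.1.le (by linarith [w.2.2])]
  simp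

/-- The Bernoulli measure `ν_w` on the Cantor set: the image of the infinite product of
`digitMeasure w` under the homeomorphism `(a_i) ↦ ∑_{i ≥ 0} 2 a_i / 3 ^ (i + 1)`. -/
def cantorMeasure (w : Ioo (0 : ℝ) 1) : Measure cantorSet :=
  (Measure.infinitePi fun _ : ℕ => digitMeasure w).map cantorSetHomeomorphNatToBool.symm

/-- `μ_w`, the push forward of `H¹ × ν_w` under the quotient map. -/
def laaksoMeasure (w : Ioo (0 : ℝ) 1) : Measure Space :=
  ((Measure.hausdorffMeasure 1 : Measure unitInterval).prod (cantorMeasure w)).map q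

/-- A doubling measure on a metric space: balls have positive finite measure, and
`m(B(x, 2r)) ≤ D m(B(x, r))` for all balls. -/
def IsDoubling {X : Type*} [PseudoMetricSpace X] [MeasurableSpace X] (m : Measure X) : Prop :=
  (∀ (x : X) (r : ℝ), 0 < r → 0 < m (Metric.ball x r) ∧ m (Metric.ball x r) < ⊤) ∧
  ∃ D : ℝ≥0, 1 < D ∧ ∀ (x : X) (r : ℝ), 0 < r →
    m (Metric.ball x (2 * r)) ≤ D * m (Metric.ball x r)

end Laakso

end

noncomputable section

namespace Laakso

/-! ### Wormhole levels -/

/-! The geometry rests on one dichotomy. A path can change the `n`-th binary digit only at a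
wormhole level of order `n + 1` (`exists_mem_of_dist_lt`), and its heights stay within its length of
the starting height. Conversely, crossing one ternary cell of generation `m` from bottom to top
suffices to change all digits of index at least `m`, because the cell contains levels of all higher
orders (`pathEDist_cell_le`). Levels of different low orders are far apart (`le_abs_sub_of_mem`), so
moving a distance of at most `3⁻¹ ^ m / 2` can change at most one of the first `m` digits.

Hence a ball of radius `r ≈ 3⁻¹ ^ m` contains a height interval times a cylinder, and is contained
in such a product with one low digit left free. A Bernoulli measure gives these cylinders comparable
masses, the ratio being bounded by powers of the smaller weight; this is doubling.

For singularity, almost every height avoids the countably many wormhole levels, so digits are almost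
everywhere well defined and have law the Bernoulli product. The strong law of large numbers then
recovers `w` from almost every point.

For differentiability, a Lipschitz `f` is absolutely continuous on each vertical line, which gives a
bounded measurable `slope f`. By doubling, almost every `x` is a Lebesgue point of it; put `D =
slope f x`. A nearby `y` is reached from `x` by switching the differing digits of index below `M = m
+ N` one at a time: go vertically to a nearby level, jump, and return. At most `N + 1` switches
occur. A column around each vertical segment has mass at least a constant depending on `N` times
that of the ball, so averaging finds in it a line on which `f - D h` is almost constant; the
Lipschitz bound carries this to the segment at cost `3⁻¹ ^ M`. The total error is `r` times a factor
of order `N (ε c⁻ᴺ + 3⁻ᴺ)`, with `c` the smaller weight, up to constants; choosing `N` first and `ε`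
afterwards makes the factor small (`abs_sub_le_of_average_le`). -/

theorem exists_ternary_digits (n N : ℕ) (hN : N < 3 ^ n) : ∃ m : Fin n → Fin 3,
    (N : ℝ) / 3 ^ n = ∑ i : Fin n, ((m i : ℕ) : ℝ) / 3 ^ ((i : ℕ) + 1) := by
  induction n generalizing N with
  | zero => exact ⟨Fin.elim0, by simp at hN; simp [hN]⟩
  | succ n ih =>
    obtain ⟨m, hm⟩ := ih (N / 3) (by rw [pow_succ] at hN; omega)
    refine ⟨Fin.snoc m ⟨N % 3, Nat.mod_lt _ (by norm_num)⟩, ?_⟩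
    rw [Fin.sum_univ_castSucc]
    simp only [Fin.snoc_castSucc, Fin.val_castSucc, Fin.snoc_last, Fin.val_last]
    rw [← hm]
    have : (N : ℝ) = 3 * ((N / 3 : ℕ) : ℝ) + ((N % 3 : ℕ) : ℝ) := by
      exact_mod_cast (Nat.div_add_mod N 3).symm
    rw [this, pow_succ]
    field_simp

theorem div_mem_wormholeHeights {n N : ℕ} (h3 : ¬ 3 ∣ N) (hN : N < 3 ^ (n + 1)) :
    (N : ℝ) / 3 ^ (n + 1) ∈ wormholeHeights n := by
  obtain ⟨m, hm⟩ := exists_ternary_digits n (N / 3) (by rw [pow_succ] at hN; omega)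
  refine ⟨Fin.snoc m ⟨N % 3, Nat.mod_lt _ (by norm_num)⟩, ?_, ?_⟩
  · rw [Fin.snoc_last, Fin.lt_def]
    exact Nat.pos_of_ne_zero fun h => h3 (Nat.dvd_of_mod_eq_zero h)
  · rw [Fin.sum_univ_castSucc]
    simp only [Fin.snoc_castSucc, Fin.val_castSucc, Fin.snoc_last, Fin.val_last]
    rw [← hm]
    have : (N : ℝ) = 3 * ((N / 3 : ℕ) : ℝ) + ((N % 3 : ℕ) : ℝ) := by
      exact_mod_cast (Nat.div_add_mod N 3).symm
    rw [this, pow_succ]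
    field_simp

theorem mem_unitInterval_of_mem {n : ℕ} {t : ℝ} (ht : t ∈ wormholeHeights n) :
    t ∈ unitInterval := by
  obtain ⟨m, -, rfl⟩ := ht
  refine ⟨Finset.sum_nonneg fun i _ => by positivity, ?_⟩
  -- The sharper bound `1 - (1 / 3) ^ k`, attained when all digits are 2, is what makes the
  -- induction close.
  have key : ∀ (k : ℕ) (m : Fin k → Fin 3),
      ∑ i : Fin k, ((m i : ℕ) : ℝ) / 3 ^ ((i : ℕ) + 1) ≤ 1 - (1 / 3) ^ k := by
    intro k
    induction k with
    | zero => simp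
    | succ k ih =>
      intro m
      rw [Fin.sum_univ_castSucc]
      have h1 := ih fun i => m i.castSucc
      have h2 : ((m (Fin.last k) : ℕ) : ℝ) ≤ 2 := by
        exact_mod_cast Nat.le_of_lt_succ (m (Fin.last k)).2
      have h3 : ((m (Fin.last k) : ℕ) : ℝ) / 3 ^ (k + 1) ≤ 2 / 3 ^ (k + 1) := by gcongr
      have h4 : (2 : ℝ) / 3 ^ (k + 1) = (1 / 3) ^ k - (1 / 3) ^ (k + 1) := by
        simp only [one_div, inv_pow, pow_succ]
        field_simp
        norm_num
      simp only [Fin.val_castSucc, Fin.val_last]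
      linarith
  have := key (n + 1) m
  have h0 : (0 : ℝ) ≤ (1 / 3) ^ (n + 1) := by positivity
  linarith

/-- Wormhole levels of distinct orders `k + 1 < l + 1` are at distance at least `3⁻¹ ^ (l + 1)`. -/
theorem le_abs_sub_of_mem {k l : ℕ} (hkl : k < l) {a b : ℝ} (ha : a ∈ wormholeHeights k)
    (hb : b ∈ wormholeHeights l) : (3 : ℝ)⁻¹ ^ (l + 1) ≤ |a - b| := by
  obtain ⟨N, hN, -⟩ := exists_int_of_mem ha
  obtain ⟨M, hM, hM3⟩ := exists_int_of_mem hb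
  -- After scaling by `3 ^ (l + 1)` both heights are integers, the first divisible by 3 and the
  -- second not, so they differ by at least 1.
  have h1 : a * 3 ^ (l + 1) = ((N * 3 ^ (l - k) : ℤ) : ℝ) := by
    push_cast
    rw [← hN, mul_assoc, ← pow_add]
    congr 2
    omega
  have hne : N * 3 ^ (l - k) - M ≠ 0 := by
    intro h
    refine hM3 ?_
    rw [← sub_eq_zero.1 h]
    exact Dvd.dvd.mul_left (dvd_pow_self _ (by omega)) _
  have h2 : (1 : ℝ) ≤ |(a - b) * 3 ^ (l + 1)| := by
    rw [sub_mul, h1, hM, ← Int.cast_sub, ← Int.cast_abs]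
    exact_mod_cast Int.one_le_abs hne
  rw [abs_mul, abs_of_pos (by positivity : (0 : ℝ) < 3 ^ (l + 1))] at h2
  rw [inv_pow, inv_le_iff_one_le_mul₀ (by positivity)]
  exact h2

/-! ### Estimates for the distance -/

theorem edist_q (z z' : Strip) : edist (q z) (q z') = pathEDist (mk z) (mk z') := rfl

theorem dist_q_le_iff {z z' : Strip} {r : ℝ} (hr : 0 ≤ r) :
    dist (q z) (q z') ≤ r ↔ pathEDist (mk z) (mk z') ≤ ENNReal.ofReal r := by
  rw [← edist_q, edist_le_ofReal hr]

theorem dist_q_lt_iff {z z' : Strip} {r : ℝ} :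
    dist (q z) (q z') < r ↔ pathEDist (mk z) (mk z') < ENNReal.ofReal r := by
  rw [← edist_q, edist_lt_ofReal]

theorem q_surjective : Function.Surjective q := exists_mk

theorem height_q (z : Strip) : height (q z) = z.1 := rfl

theorem exists_path_of_dist_lt {z z' : Strip} {r : ℝ} (h : dist (q z) (q z') < r) :
    ∃ γ : Path (mk z) (mk z'), ∀ s, |gluingHeight (γ s) - z.1| < r := by
  have hr : 0 < r := dist_nonneg.trans_lt h
  rw [dist_q_lt_iff] at h
  simp only [pathEDist, iInf_lt_iff] at h
  obtain ⟨p, ⟨γ, hγ⟩, hp⟩ := h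
  refine ⟨γ, fun s => ?_⟩
  have := (length_ge γ p hγ s).trans_lt hp
  exact (ENNReal.ofReal_lt_ofReal_iff hr).1 this

theorem abs_sub_le_dist (z z' : Strip) : |(z'.1 : ℝ) - z.1| ≤ dist (q z) (q z') := by
  refine le_of_forall_gt fun r hr => ?_
  obtain ⟨γ, hγ⟩ := exists_path_of_dist_lt hr
  have := hγ 1
  rwa [Path.target] at this

theorem abs_height_sub_le (x y : Space) : |height y - height x| ≤ dist x y := by
  obtain ⟨z, rfl⟩ := q_surjective x
  obtain ⟨z', rfl⟩ := q_surjective y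
  exact abs_sub_le_dist z z'

/-- If the `n`-th digits of two points at distance less than `r` differ, then there is a wormhole
level of order `n + 1` within `r`. -/
theorem exists_mem_of_dist_lt {z z' : Strip} {r : ℝ} (h : dist (q z) (q z') < r) {n : ℕ}
    (hn : addr z.2 n ≠ addr z'.2 n) : ∃ a ∈ wormholeHeights n, |a - z.1| < r := by
  obtain ⟨γ, hγ⟩ := exists_path_of_dist_lt h
  have : ∃ s, gluingHeight (γ s) ∈ wormholeHeights n := by
    cases hu : addr z.2 n <;> cases hv : addr z'.2 n
    · exact absurd (hu.trans hv.symm) hn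
    · exact exists_height_mem γ hu hv
    · obtain ⟨s, hs⟩ := exists_height_mem γ.symm hv hu
      exact ⟨_, hs⟩
    · exact absurd (hu.trans hv.symm) hn
  obtain ⟨s, hs⟩ := this
  exact ⟨_, hs, hγ s⟩

theorem dist_q_vertical (t t' : unitInterval) (u : cantorSet) :
    dist (q (t, u)) (q (t', u)) ≤ |(t' : ℝ) - t| := by
  rw [dist_q_le_iff (abs_nonneg _)]
  have hbd : ∀ r : unitInterval, min (t : ℝ) t' ≤ (1 - r) * t + r * t' ∧
      (1 - r) * t + r * t' ≤ max (t : ℝ) t' := by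
    intro r
    have h0 := r.2.1
    have h1 := r.2.2
    constructor
    · nlinarith [min_le_left (t : ℝ) t', min_le_right (t : ℝ) t']
    · nlinarith [le_max_left (t : ℝ) t', le_max_right (t : ℝ) t']
  let τ : unitInterval → unitInterval := fun r => ⟨(1 - r) * t + r * t',
    (le_min t.2.1 t'.2.1).trans (hbd r).1, (hbd r).2.trans (max_le t.2.2 t'.2.2)⟩
  let γ : Path (mk (t, u)) (mk (t', u)) :=
    { toFun := fun r => mk (τ r, u)
      continuous_toFun := continuous_mk.comp
        ((Continuous.subtype_mk (by fun_prop) _).prodMk continuous_const)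
      source' := by
        have : τ 0 = t := Subtype.ext (by simp [τ])
        rw [this]
      target' := by
        have : τ 1 = t' := Subtype.ext (by simp [τ])
        rw [this] }
  refine (iInf₂_le (range fun r => (τ r, u)) ⟨γ, range_comp mk fun r => (τ r, u)⟩).trans ?_
  rw [← max_sub_min_eq_abs']
  refine (length_le_of_subset _ u (min (t : ℝ) t') (max (t : ℝ) t') ?_).trans
    (by rw [max_comm, min_comm])
  rintro _ ⟨r, rfl⟩
  exact ⟨rfl, hbd r⟩

/-- A digit that jumps at height `c` is one-sided continuous: from the left with the strict
inequality, from the right with the weak one. The two versions agree in the quotient, which makes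
the switching path continuous. -/
theorem continuousWithinAt_ite_lt {α : Type*} [TopologicalSpace α] (c : ℝ) (b b' : α)
    (r : unitInterval) :
    ContinuousWithinAt (fun r : unitInterval => if c < r then b' else b) (Iic r) r := by
  by_cases h : c < r
  · have : ∀ᶠ x : unitInterval in 𝓝 r, c < x :=
      continuous_subtype_val.continuousAt.eventually (lt_mem_nhds h)
    refine (continuousAt_const (y := b') |>.congr ?_).continuousWithinAt
    filter_upwards [this] with x hx
    simp [hx]
  · refine (continuousWithinAt_const (b := b)).congr (fun x hx => ?_) (by simp [h])
    have : ¬ c < x := fun h' => h (h'.trans_le hx)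
    simp [this]

theorem continuousWithinAt_ite_le {α : Type*} [TopologicalSpace α] (c : ℝ) (b b' : α)
    (r : unitInterval) :
    ContinuousWithinAt (fun r : unitInterval => if c ≤ r then b' else b) (Ici r) r := by
  by_cases h : c ≤ r
  · refine (continuousWithinAt_const (b := b')).congr (fun x hx => ?_) (by simp [h])
    have : c ≤ x := h.trans hx
    simp [this]
  · have : ∀ᶠ x : unitInterval in 𝓝 r, (x : ℝ) < c :=
      continuous_subtype_val.continuousAt.eventually (gt_mem_nhds (not_le.1 h))
    refine (continuousAt_const (y := b) |>.congr ?_).continuousWithinAt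
    filter_upwards [this] with x hx
    simp [not_le.2 hx]

/-- Joining the bottom and the top of a cell of generation `m` by changing the `n`-th digit,
`n ≥ m`, at distance `3⁻¹ ^ (n + 1)` from the bottom. -/
theorem pathEDist_cell_le {j m : ℕ} (hj : j + 1 ≤ 3 ^ m) (c c' : unitInterval)
    (hc : (c : ℝ) = j / 3 ^ m) (hc' : (c' : ℝ) = (j + 1) / 3 ^ m) {s s' : ℕ → Bool}
    (hs : ∀ k < m, s k = s' k) :
    pathEDist (mk (c, pt s)) (mk (c', pt s')) ≤ ENNReal.ofReal (3 / 2 * (3 : ℝ)⁻¹ ^ m) := by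
  -- Switching times in the parameter of the cell, rescaled to `[0,1]`; for `n ≥ m` they decrease to
  -- 0, so that infinitely many digits change just above the bottom.
  let θ : ℕ → ℝ := fun n => 3 ^ m * (3 : ℝ)⁻¹ ^ (n + 1)
  have hθ : ∀ n, m ≤ n → θ n = (3 : ℝ)⁻¹ ^ (n - m + 1) := by
    intro n hn
    have : n + 1 = m + (n - m + 1) := by omega
    simp only [θ]
    rw [this, pow_add, ← mul_assoc, ← mul_pow]
    norm_num
  have hj' : ((j : ℝ) + 1) ≤ 3 ^ m := by exact_mod_cast hj
  have h3 : (0 : ℝ) < 3 ^ m := by positivity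
  let τ : unitInterval → unitInterval := fun r => ⟨(j + r) / 3 ^ m, by
    have := r.2.1
    positivity, by
    rw [div_le_one h3]
    linarith [r.2.2]⟩
  have hτ : Continuous τ := Continuous.subtype_mk (by fun_prop) _
  have hτ0 : τ 0 = c := Subtype.ext (by simp [τ, hc])
  have hτ1 : τ 1 = c' := Subtype.ext (by simp [τ, hc'])
  have hlevel : ∀ (r : unitInterval) (n : ℕ), m ≤ n → θ n = r →
      (τ r : ℝ) ∈ wormholeHeights n := by
    intro r n hn hr
    -- The numerator is 1 modulo 3, so the order is exactly `n + 1`.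
    have h1 : (τ r : ℝ) = ((j * 3 ^ (n + 1 - m) + 1 : ℕ) : ℝ) / 3 ^ (n + 1) := by
      simp only [τ, ← hr, hθ n hn]
      have : n + 1 = (n - m + 1) + m := by omega
      rw [show n + 1 - m = n - m + 1 by omega, this, pow_add, inv_pow]
      push_cast
      field_simp
      ring
    rw [h1]
    refine div_mem_wormholeHeights ?_ ?_
    · rw [show n + 1 - m = (n - m) + 1 by omega, pow_succ, ← mul_assoc]
      omega
    · have h2 : 3 ^ (n + 1) = 3 ^ m * 3 ^ (n + 1 - m) := by
        rw [← pow_add]; congr 1; omega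
      rw [h2]
      have h4 : 3 ≤ 3 ^ (n + 1 - m) := by
        calc 3 = 3 ^ 1 := by norm_num
          _ ≤ _ := Nat.pow_le_pow_right (by norm_num) (by omega)
      nlinarith
  have hθinj : ∀ k n, θ k = θ n → k = n := by
    intro k n h
    have := mul_left_cancel₀ h3.ne' h
    have := pow_right_injective₀ (by norm_num : (0 : ℝ) < 3⁻¹) (by norm_num) this
    omega
  let Zm : unitInterval → ℕ → Bool := fun r n => if θ n < r then s' n else s n
  let Zp : unitInterval → ℕ → Bool := fun r n => if θ n ≤ r then s' n else s n
  -- The two addresses differ in at most one digit, and only at a level where that digit is glued.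
  have hZ : ∀ r, mk (τ r, pt (Zm r)) = mk (τ r, pt (Zp r)) := by
    intro r
    have hoff : ∀ k, (m ≤ k → θ k ≠ r) → Zm r k = Zp r k := by
      intro k hk
      by_cases hkm : m ≤ k
      · simp only [Zm, Zp, lt_iff_le_and_ne, hk hkm, ne_eq, not_false_eq_true, and_true]
      · simp only [Zm, Zp, hs k (not_le.1 hkm), ite_self]
    by_cases hex : ∃ n : ℕ, m ≤ n ∧ θ n = r
    · obtain ⟨n, hmn, hn⟩ := hex
      exact mk_eq_of_eqOn (hlevel r n hmn hn) fun k hk =>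
        hoff k fun _ h => hk (hθinj k n (h.trans hn.symm))
    · push Not at hex
      rw [show Zm r = Zp r from funext fun k => hoff k (hex k)]
  have hcomp : ∀ (Z : unitInterval → ℕ → Bool) (A : Set unitInterval) (r : unitInterval),
      ContinuousWithinAt Z A r → ContinuousWithinAt (fun r => mk (τ r, pt (Z r))) A r := by
    intro Z A r h
    refine continuous_mk.continuousAt.comp_continuousWithinAt
      (hτ.continuousWithinAt.prodMk ?_)
    exact cantorSetHomeomorphNatToBool.symm.continuous.continuousAt.comp_continuousWithinAt h
  have hcont : Continuous (fun r => mk (τ r, pt (Zm r))) := by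
    refine continuous_iff_continuousAt.2 fun r => continuousAt_iff_continuous_left_right.2 ⟨?_, ?_⟩
    · exact hcomp Zm _ r (continuousWithinAt_pi.2 fun n => continuousWithinAt_ite_lt _ _ _ _)
    · rw [funext hZ]
      exact hcomp Zp _ r (continuousWithinAt_pi.2 fun n => continuousWithinAt_ite_le _ _ _ _)
  have hZ0 : Zm 0 = s := by
    ext n
    have : ¬ θ n < 0 := not_lt.2 (by positivity)
    simp only [Zm, Set.Icc.coe_zero, this, if_false]
  have hZ1 : Zm 1 = s' := by
    ext n
    by_cases hn : m ≤ n
    · have : θ n < 1 := by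
        rw [hθ n hn]
        exact pow_lt_one₀ (by norm_num) (by norm_num) (by omega)
      simp only [Zm, Set.Icc.coe_one, this, if_true]
    · simp only [Zm, hs n (not_le.1 hn), ite_self]
  let γ : Path (mk (c, pt s)) (mk (c', pt s')) :=
    { toFun := fun r => mk (τ r, pt (Zm r))
      continuous_toFun := hcont
      source' := by rw [hZ0, hτ0]
      target' := by rw [hZ1, hτ1] }
  refine (iInf₂_le (range fun r => (τ r, pt (Zm r)))
    ⟨γ, range_comp mk fun r => (τ r, pt (Zm r))⟩).trans ?_
  -- For `r` in `(3⁻¹ ^ (n + 1), 3⁻¹ ^ n]` the path stays on the single vertical line `w n`. `P n`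
  -- covers that piece by the whole segment from the bottom, which keeps the lengths geometric, with
  -- sum `3 / 2` times the height of the cell.
  let w : ℕ → cantorSet := fun n => pt fun k => if n + m ≤ k then s' k else s k
  let P : ℕ → Set Strip := fun n => {z | z.2 = w n ∧ (c : ℝ) ≤ (z.1 : ℝ) ∧
    (z.1 : ℝ) ≤ c + (3 : ℝ)⁻¹ ^ m * (3 : ℝ)⁻¹ ^ n}
  have hsub : (range fun r => (τ r, pt (Zm r))) ⊆ {(c, pt s)} ∪ ⋃ n, P n := by
    rintro _ ⟨r, rfl⟩
    by_cases hr : r = 0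
    · left; simp only [hr, hτ0, hZ0, mem_singleton_iff]
    right
    have hr0 : (0 : ℝ) < r := lt_of_le_of_ne r.2.1 fun h => hr (Subtype.ext h.symm)
    obtain ⟨n, hn1, hn2⟩ := exists_nat_pow_near_of_lt_one hr0 r.2.2
      (by norm_num : (0 : ℝ) < 3⁻¹) (by norm_num)
    refine mem_iUnion.2 ⟨n, ?_, ?_, ?_⟩
    · simp only [w]
      congr 1
      ext k
      simp only [Zm]
      by_cases hkm : m ≤ k
      · by_cases hk : n + m ≤ k
        · have : θ k < r := by
            rw [hθ k hkm]
            exact (pow_le_pow_of_le_one (by norm_num) (by norm_num) (by omega)).trans_lt hn1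
          simp only [this, hk, if_true]
        · have : ¬ θ k < r := by
            rw [hθ k hkm]
            exact not_lt.2
              (hn2.trans (pow_le_pow_of_le_one (by norm_num) (by norm_num) (by omega)))
          simp only [this, hk, if_false]
      · simp only [hs k (not_le.1 hkm), ite_self]
    · simp only [τ, hc]
      gcongr
      linarith
    · simp only [τ, hc, add_div, inv_pow]
      rw [div_eq_inv_mul (r : ℝ), ← inv_pow 3 n]
      gcongr
  have hsum : (∑' n : ℕ, ENNReal.ofReal ((3 : ℝ)⁻¹ ^ m * (3 : ℝ)⁻¹ ^ n)) =
      ENNReal.ofReal (3 / 2 * (3 : ℝ)⁻¹ ^ m) := by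
    rw [← ENNReal.ofReal_tsum_of_nonneg (fun n => by positivity)
      ((summable_geometric_of_lt_one (by norm_num) (by norm_num)).mul_left _), tsum_mul_left,
      tsum_geometric_of_lt_one (by norm_num) (by norm_num)]
    congr 1
    norm_num
    ring
  calc length (range fun r => (τ r, pt (Zm r)))
      ≤ length ({(c, pt s)} ∪ ⋃ n, P n) :=
        measure_mono (image_mono hsub)
    _ ≤ length {(c, pt s)} + ∑' n, length (P n) := by
        unfold length
        rw [image_union, image_iUnion]
        exact (measure_union_le _ _).trans (add_le_add le_rfl (measure_iUnion_le _))
    _ ≤ 0 + ∑' n : ℕ, ENNReal.ofReal ((3 : ℝ)⁻¹ ^ m * (3 : ℝ)⁻¹ ^ n) := by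
        refine add_le_add (length_singleton _).le (ENNReal.tsum_le_tsum fun n => ?_)
        refine (length_le_of_subset (P n) (w n) c _ (fun z hz => hz)).trans ?_
        rw [add_sub_cancel_left]
    _ = ENNReal.ofReal (3 / 2 * (3 : ℝ)⁻¹ ^ m) := by rw [zero_add, hsum]

theorem exists_cell (t : unitInterval) (m : ℕ) : ∃ j : ℕ, j + 1 ≤ 3 ^ m ∧
    (j : ℝ) / 3 ^ m ≤ t ∧ (t : ℝ) ≤ (j + 1) / 3 ^ m := by
  have h3 : (0 : ℝ) < 3 ^ m := by positivity
  rcases eq_or_lt_of_le t.2.2 with h | h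
  · refine ⟨3 ^ m - 1, by
      have := Nat.one_le_pow m 3 (by norm_num)
      omega, ?_, ?_⟩
    · rw [h, div_le_one h3]
      have := Nat.sub_le (3 ^ m) 1
      exact_mod_cast this
    · have h1 : (((3 ^ m - 1 : ℕ) : ℝ) + 1) = 3 ^ m := by
        rw [Nat.cast_sub (Nat.one_le_pow _ _ (by norm_num))]
        simp
      rw [h1, div_self h3.ne', h]
  · have h0 : (0 : ℝ) ≤ t * 3 ^ m := mul_nonneg t.2.1 h3.le
    refine ⟨⌊(t : ℝ) * 3 ^ m⌋₊, ?_, ?_, ?_⟩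
    · rw [Nat.add_one_le_iff, Nat.floor_lt h0]
      push_cast
      nlinarith
    · rw [div_le_iff₀ h3]
      exact Nat.floor_le h0
    · rw [le_div_iff₀ h3]
      exact (Nat.lt_floor_add_one _).le

/-- Points at the same height whose first `m` digits agree are at distance at most `4 / 3 ^ m`. -/
theorem dist_q_le_of_eqOn (t : unitInterval) {u v : cantorSet} {m : ℕ}
    (h : ∀ k < m, addr u k = addr v k) : dist (q (t, u)) (q (t, v)) ≤ 4 * (3 : ℝ)⁻¹ ^ m := by
  obtain ⟨j, hj, h1, h2⟩ := exists_cell t m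
  have h3 : (0 : ℝ) < 3 ^ m := by positivity
  have hj' : ((j : ℝ) + 1) ≤ 3 ^ m := by exact_mod_cast hj
  let c : unitInterval := ⟨j / 3 ^ m, by positivity, h1.trans t.2.2⟩
  let c' : unitInterval := ⟨(j + 1) / 3 ^ m, by positivity, (div_le_one h3).2 hj'⟩
  have hcc : (c' : ℝ) - c = (3 : ℝ)⁻¹ ^ m := by
    simp only [c, c', inv_pow]
    field_simp
    ring
  have hmid := pathEDist_cell_le hj c c' rfl rfl h
  simp only [Homeomorph.symm_apply_apply] at hmid
  rw [← dist_q_le_iff (by positivity)] at hmid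
  have e1 := dist_q_vertical t c u
  have e2 := dist_q_vertical c' t v
  have a1 : |(c : ℝ) - t| ≤ (3 : ℝ)⁻¹ ^ m := by
    have : (c : ℝ) ≤ t := h1
    have : (t : ℝ) ≤ c' := h2
    rw [abs_le]; constructor <;> linarith
  have a2 : |(t : ℝ) - c'| ≤ (3 : ℝ)⁻¹ ^ m := by
    have : (c : ℝ) ≤ t := h1
    have : (t : ℝ) ≤ c' := h2
    rw [abs_le]; constructor <;> linarith
  -- Descend to the bottom, cross the cell, come back from the top: `1 + 3 / 2 + 1 ≤ 4` cell
  -- heights.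
  have htri := dist_triangle4 (q (t, u)) (q (c, u)) (q (c', v)) (q (t, v))
  have h0 : (0 : ℝ) ≤ (3 : ℝ)⁻¹ ^ m := by positivity
  linarith

theorem dist_q_le {t t' : unitInterval} {u v : cantorSet} {m : ℕ}
    (h : ∀ k < m, addr u k = addr v k) :
    dist (q (t, u)) (q (t', v)) ≤ |(t' : ℝ) - t| + 4 * (3 : ℝ)⁻¹ ^ m :=
  (dist_triangle _ (q (t', u)) _).trans
    (add_le_add (dist_q_vertical t t' u) (dist_q_le_of_eqOn t' h))

/-! ### Topology of the Laakso space -/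

theorem eventually_eqOn_addr (u : cantorSet) (m : ℕ) :
    ∀ᶠ v in 𝓝 u, ∀ k < m, addr u k = addr v k := by
  have h : ∀ k ∈ Finset.range m, ∀ᶠ v in 𝓝 u, addr u k = addr v k := by
    intro k _
    have hc : Continuous fun v : cantorSet => addr v k :=
      (continuous_apply k).comp cantorSetHomeomorphNatToBool.continuous
    have := (hc.continuousAt (x := u)).eventually
      ((isOpen_discrete {addr u k}).mem_nhds rfl)
    filter_upwards [this] with v hv
    exact hv.symm
  filter_upwards [(Finset.eventually_all _).2 h] with v hv k hk
  exact hv k (Finset.mem_range.2 hk)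

theorem continuous_q : Continuous q := by
  refine continuous_iff_continuousAt.2 fun ⟨t, u⟩ => Metric.tendsto_nhds.2 fun ε hε => ?_
  obtain ⟨m, hm⟩ := exists_pow_lt_of_lt_one (show 0 < ε / 8 by linarith)
    (show (3 : ℝ)⁻¹ < 1 by norm_num)
  have h1 : ∀ᶠ z : Strip in 𝓝 (t, u), ∀ k < m, addr u k = addr z.2 k :=
    (continuous_snd.continuousAt (x := (t, u))).eventually (eventually_eqOn_addr u m)
  have h2 : ∀ᶠ z : Strip in 𝓝 (t, u), dist z.1 t < ε / 2 :=
    (continuous_fst.continuousAt (x := (t, u))).eventually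
      (Metric.ball_mem_nhds t (by linarith))
  filter_upwards [h1, h2] with ⟨t', v⟩ h1 h2
  rw [dist_comm]
  refine (dist_q_le h1).trans_lt ?_
  rw [Subtype.dist_eq, Real.dist_eq] at h2
  simp only at h2
  linarith

instance : CompactSpace cantorSet := isCompact_iff_compactSpace.1 isCompact_cantorSet

instance : CompactSpace Space := by
  rw [← isCompact_univ_iff, ← q_surjective.range_eq]
  exact isCompact_range continuous_q

/-- A continuous map from a compact space to a Hausdorff space is closed. So the metric topology is
the quotient topology, and functions continuous on `Gluing` are continuous, hence Borel, on `Space`.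
-/
theorem isQuotientMap_q : IsQuotientMap q :=
  continuous_q.isClosedMap.isQuotientMap continuous_q q_surjective

theorem lipschitzWith_height : LipschitzWith 1 height :=
  LipschitzWith.of_dist_le_mul fun x y => by
    rw [dist_comm, dist_comm x, Real.dist_eq, NNReal.coe_one, one_mul, dist_comm]
    exact abs_height_sub_le x y

/-- The `n`-th binary digit of a point, with the value `0` on the wormhole levels of
order `n + 1`. -/
def digit (n : ℕ) (x : Space) : Bool := decide (0 < weightedDigit n x)

theorem measurable_digit (n : ℕ) : Measurable (digit n) := by
  have hc : Continuous fun x : Space => weightedDigit n x :=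
    isQuotientMap_q.continuous_iff.2 ((continuous_weightedDigit n).comp continuous_mk)
  refine measurable_to_bool ?_
  have : digit n ⁻¹' {true} = {x : Space | 0 < weightedDigit n x} := by
    ext x
    simp [digit]
  rw [this]
  exact (isOpen_lt continuous_const hc).measurableSet

theorem digit_q {n : ℕ} {z : Strip} (h : (z.1 : ℝ) ∉ wormholeHeights n) :
    digit n (q z) = addr z.2 n := by
  have hpos := ((wormholeHeights_finite n).isClosed.notMem_iff_infDist_pos
    ⟨_, inv_pow_mem_wormholeHeights n⟩).1 h
  unfold digit q
  rw [weightedDigit_mk]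
  cases addr z.2 n <;> simp [hpos]

/-! ### Measures of balls, doubling, and mutual singularity. -/

section Measures

/-! ### Length measure on the unit interval -/

theorem hausdorffMeasure_unitInterval :
    (Measure.hausdorffMeasure 1 : Measure unitInterval) = volume := by
  ext s hs
  rw [← (isometry_subtype_coe (s := unitInterval)).hausdorffMeasure_image (Or.inl zero_le_one),
    hausdorffMeasure_real, Measure.Subtype.volume_def,
    comap_subtype_coe_apply measurableSet_Icc]

theorem volume_image_coe (s : Set unitInterval) :
    volume s = volume (Subtype.val '' s : Set ℝ) := by
  rw [Measure.Subtype.volume_def, comap_subtype_coe_apply measurableSet_Icc]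

theorem volume_abs_sub_lt_le (t : unitInterval) (r : ℝ) :
    volume {t' : unitInterval | |(t' : ℝ) - t| < r} ≤ ENNReal.ofReal (2 * r) := by
  rw [volume_image_coe, ← Real.volume_ball (t : ℝ) r]
  refine measure_mono ?_
  rintro _ ⟨t', ht', rfl⟩
  exact ht'

theorem le_volume_abs_sub_le (t : unitInterval) {δ : ℝ} (hδ : δ ≤ 1 / 2) :
    ENNReal.ofReal δ ≤ volume {t' : unitInterval | |(t' : ℝ) - t| ≤ δ} := by
  rw [volume_image_coe]
  have h0 := t.2.1
  have h1 := t.2.2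
  rcases le_total (t : ℝ) (1 / 2) with h | h
  · calc ENNReal.ofReal δ = volume (Icc (t : ℝ) (t + δ)) := by
          rw [Real.volume_Icc, add_sub_cancel_left]
      _ ≤ _ := measure_mono fun s hs => by
          refine ⟨⟨s, by linarith [hs.1], by linarith [hs.2]⟩, ?_, rfl⟩
          rw [mem_ofPred_eq, abs_le]
          constructor <;> linarith [hs.1, hs.2]
  · calc ENNReal.ofReal δ = volume (Icc (t - δ : ℝ) t) := by
          rw [Real.volume_Icc, sub_sub_cancel]
      _ ≤ _ := measure_mono fun s hs => by
          refine ⟨⟨s, by linarith [hs.1], by linarith [hs.2]⟩, ?_, rfl⟩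
          rw [mem_ofPred_eq, abs_le]
          constructor <;> linarith [hs.1, hs.2]

/-! ### Cylinders -/

variable (w : Ioo (0 : ℝ) 1)

/-- The mass of a digit. -/
def weight (b : Bool) : ℝ := if b then 1 - w else w

/-- The smaller one of the masses of the two digits. -/
def minWeight : ℝ := min (w : ℝ) (1 - w)

theorem minWeight_pos : 0 < minWeight w := lt_min w.2.1 (by linarith [w.2.2])

theorem minWeight_lt_one : minWeight w < 1 := (min_le_left _ _).trans_lt w.2.2

theorem minWeight_le_weight (b : Bool) : minWeight w ≤ weight w b := by
  cases b
  · exact min_le_left _ _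
  · exact min_le_right _ _

theorem weight_pos (b : Bool) : 0 < weight w b :=
  (minWeight_pos w).trans_le (minWeight_le_weight w b)

theorem weight_le_one (b : Bool) : weight w b ≤ 1 := by
  cases b
  · exact w.2.2.le
  · simp only [weight, if_true]
    linarith [w.2.1]

theorem digitMeasure_singleton (b : Bool) : digitMeasure w {b} = ENNReal.ofReal (weight w b) := by
  cases b <;> simp [digitMeasure, weight]

theorem measurable_addr : Measurable (fun u : cantorSet => addr u) :=
  cantorSetHomeomorphNatToBool.continuous.measurable

theorem measurable_pt : Measurable pt :=
  cantorSetHomeomorphNatToBool.symm.continuous.measurable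

instance : IsProbabilityMeasure (cantorMeasure w) :=
  Measure.isProbabilityMeasure_map measurable_pt.aemeasurable

/-- The points of the Cantor set whose digits with index in `s` agree with those of `u`. -/
def cylinder (u : cantorSet) (s : Finset ℕ) : Set cantorSet := {v | ∀ k ∈ s, addr v k = addr u k}

theorem measurableSet_cylinder (u : cantorSet) (s : Finset ℕ) :
    MeasurableSet (cylinder u s) := by
  have : cylinder u s = ⋂ k ∈ s, (fun v : cantorSet => addr v k) ⁻¹' {addr u k} := by
    ext v
    simp [cylinder]
  rw [this]
  exact s.measurableSet_biInter fun k _ =>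
    ((measurable_pi_apply k).comp measurable_addr) (measurableSet_singleton _)

/-- The mass of a cylinder. -/
def mass (u : cantorSet) (s : Finset ℕ) : ℝ := ∏ k ∈ s, weight w (addr u k)

theorem mass_pos (u : cantorSet) (s : Finset ℕ) : 0 < mass w u s :=
  Finset.prod_pos fun _ _ => weight_pos w _

theorem mass_congr {u v : cantorSet} {s : Finset ℕ} (h : ∀ k ∈ s, addr v k = addr u k) :
    mass w v s = mass w u s := Finset.prod_congr rfl fun k hk => by rw [h k hk]

theorem cantorMeasure_cylinder (u : cantorSet) (s : Finset ℕ) :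
    cantorMeasure w (cylinder u s) = ENNReal.ofReal (mass w u s) := by
  rw [cantorMeasure, Measure.map_apply measurable_pt (measurableSet_cylinder u s)]
  have : pt ⁻¹' cylinder u s = (s : Set ℕ).pi fun k => {addr u k} := by
    ext v
    simp [cylinder, Set.mem_pi]
  rw [this, Measure.infinitePi_pi _ fun k _ => measurableSet_singleton _]
  simp only [digitMeasure_singleton]
  rw [mass, ENNReal.ofReal_prod_of_nonneg fun k _ => (weight_pos w _).le]

theorem mass_le_mass_erase (u : cantorSet) (s : Finset ℕ) (k : ℕ) :
    mass w u s ≤ mass w u (s.erase k) := by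
  by_cases hk : k ∈ s
  · rw [mass, mass, ← Finset.mul_prod_erase s _ hk]
    exact mul_le_of_le_one_left (mass_pos w u _).le (weight_le_one w _)
  · rw [Finset.erase_eq_of_notMem hk]

theorem minWeight_mul_mass_erase_le (u : cantorSet) (s : Finset ℕ) (k : ℕ) :
    minWeight w * mass w u (s.erase k) ≤ mass w u s := by
  by_cases hk : k ∈ s
  · rw [mass, mass, ← Finset.mul_prod_erase s _ hk]
    exact mul_le_mul_of_nonneg_right (minWeight_le_weight w _) (mass_pos w u _).le
  · rw [Finset.erase_eq_of_notMem hk]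
    exact mul_le_of_le_one_left (mass_pos w u _).le (minWeight_lt_one w).le

theorem pow_mul_mass_le (u : cantorSet) (m N : ℕ) :
    minWeight w ^ N * mass w u (Finset.range m) ≤ mass w u (Finset.range (m + N)) := by
  induction N with
  | zero => simp
  | succ N ih =>
    rw [← add_assoc, mass, mass, Finset.prod_range_succ, pow_succ, mul_right_comm]
    exact mul_le_mul ih (minWeight_le_weight w _) (minWeight_pos w).le (mass_pos w u _).le

/-! ### The measure of balls -/

theorem laaksoMeasure_eq :
    laaksoMeasure w = ((volume : Measure unitInterval).prod (cantorMeasure w)).map q := by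
  rw [laaksoMeasure, hausdorffMeasure_unitInterval]

theorem measurable_q : Measurable q := continuous_q.measurable

instance : IsProbabilityMeasure (laaksoMeasure w) := by
  rw [laaksoMeasure_eq]
  exact Measure.isProbabilityMeasure_map measurable_q.aemeasurable

/-- Only one wormhole level of order at most `m` can be closer to `t` than `3⁻¹ ^ m / 2`. -/
theorem exists_unique_order (t : ℝ) {r : ℝ} {m : ℕ} (hr : 2 * r ≤ (3 : ℝ)⁻¹ ^ m) :
    ∃ k₀, ∀ k < m, (∃ a ∈ wormholeHeights k, |a - t| < r) → k = k₀ := by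
  by_cases h : ∃ k < m, ∃ a ∈ wormholeHeights k, |a - t| < r
  · obtain ⟨k₀, hk₀, a, ha, har⟩ := h
    refine ⟨k₀, fun k hk ⟨b, hb, hbr⟩ => ?_⟩
    have hab : |a - b| < 2 * r := by
      have := abs_sub_le a t b
      rw [abs_sub_comm t b] at this
      linarith
    rcases lt_trichotomy k k₀ with hlt | heq | hlt
    · have h1 := le_abs_sub_of_mem hlt hb ha
      rw [abs_sub_comm] at h1
      have h2 : (3 : ℝ)⁻¹ ^ m ≤ (3 : ℝ)⁻¹ ^ (k₀ + 1) :=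
        pow_le_pow_of_le_one (by norm_num) (by norm_num) (by omega)
      linarith
    · exact heq
    · have h1 := le_abs_sub_of_mem hlt ha hb
      have h2 : (3 : ℝ)⁻¹ ^ m ≤ (3 : ℝ)⁻¹ ^ (k + 1) :=
        pow_le_pow_of_le_one (by norm_num) (by norm_num) (by omega)
      linarith
  · exact ⟨0, fun k hk hk' => absurd ⟨k, hk, hk'⟩ h⟩

/-- Within the ball all of the first `m` digits are frozen, except possibly the one whose level is
near `t`. The factor `(minWeight w)⁻¹` pays for freeing that digit. -/
theorem measure_ball_le (t : unitInterval) (u : cantorSet) {r : ℝ} (hr0 : 0 ≤ r) {m : ℕ}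
    (hr : 2 * r ≤ (3 : ℝ)⁻¹ ^ m) : laaksoMeasure w (Metric.ball (q (t, u)) r) ≤
      ENNReal.ofReal (2 * r * ((minWeight w)⁻¹ * mass w u (Finset.range m))) := by
  obtain ⟨k₀, hk₀⟩ := exists_unique_order t hr
  rw [laaksoMeasure_eq, Measure.map_apply measurable_q measurableSet_ball]
  have hsub : q ⁻¹' Metric.ball (q (t, u)) r ⊆
      {t' : unitInterval | |(t' : ℝ) - t| < r} ×ˢ cylinder u ((Finset.range m).erase k₀) := by
    rintro z hz
    rw [mem_preimage, Metric.mem_ball, dist_comm] at hz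
    refine ⟨(abs_sub_le_dist _ _).trans_lt hz, fun k hk => ?_⟩
    rw [Finset.mem_erase, Finset.mem_range] at hk
    by_contra hne
    exact hk.1 (hk₀ k hk.2 (exists_mem_of_dist_lt hz (Ne.symm hne)))
  refine (measure_mono hsub).trans ?_
  rw [Measure.prod_prod, cantorMeasure_cylinder, ENNReal.ofReal_mul (by positivity)]
  gcongr
  · exact volume_abs_sub_lt_le t r
  · rw [le_inv_mul_iff₀ (minWeight_pos w)]
    exact minWeight_mul_mass_erase_le w u _ _

/-- By `dist_q_le` the ball contains a product of a height interval and a cylinder. At least one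
half of the interval around `t` lies in `[0,1]` when `δ ≤ 1 / 2`. -/
theorem le_measure_ball (t : unitInterval) (u : cantorSet) {r δ : ℝ} {M : ℕ} (hδ0 : 0 ≤ δ)
    (hδ : δ ≤ 1 / 2) (hr : δ + 4 * (3 : ℝ)⁻¹ ^ M < r) :
    ENNReal.ofReal (δ * mass w u (Finset.range M)) ≤
      laaksoMeasure w (Metric.ball (q (t, u)) r) := by
  rw [laaksoMeasure_eq, Measure.map_apply measurable_q measurableSet_ball]
  have hsub : {t' : unitInterval | |(t' : ℝ) - t| ≤ δ} ×ˢ cylinder u (Finset.range M) ⊆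
      q ⁻¹' Metric.ball (q (t, u)) r := by
    rintro ⟨t', v⟩ ⟨ht', hv⟩
    rw [mem_preimage, Metric.mem_ball, dist_comm]
    refine (dist_q_le fun k hk => (hv k (Finset.mem_range.2 hk)).symm).trans_lt ?_
    rw [mem_ofPred_eq] at ht'
    linarith
  refine le_trans ?_ (measure_mono hsub)
  rw [Measure.prod_prod, cantorMeasure_cylinder, ENNReal.ofReal_mul hδ0]
  gcongr
  exact le_volume_abs_sub_le t hδ

theorem measure_ball_two_mul_le_of_le (x : Space) {r : ℝ} (hr0 : 0 < r) (hr : r ≤ 1 / 4) :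
    laaksoMeasure w (Metric.ball x (2 * r)) ≤
      ENNReal.ofReal (12 * (minWeight w)⁻¹ ^ 5) * laaksoMeasure w (Metric.ball x r) := by
  obtain ⟨⟨t, u⟩, rfl⟩ := q_surjective x
  obtain ⟨m, hm1, hm2⟩ := exists_nat_pow_near_of_lt_one (show 0 < 4 * r by linarith)
    (by linarith) (by norm_num : (0 : ℝ) < 3⁻¹) (by norm_num)
  have h1 := measure_ball_le w t u (r := 2 * r) (by linarith) (m := m) (by linarith)
  -- Since `3⁻¹ ^ (m + 1) < 4 * r`, the bound is `r / 3 + 16 * r / 27 < r`. The four extra digits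
  -- and the one freed above give the fifth power in the constant.
  have h2 := le_measure_ball w t u (r := r) (δ := r / 3) (M := m + 4) (by linarith) (by linarith)
    (by
      rw [pow_succ] at hm1
      rw [pow_add]
      norm_num at hm1 ⊢
      linarith)
  have hc := minWeight_pos w
  calc _ ≤ _ := h1
    _ ≤ ENNReal.ofReal (12 * (minWeight w)⁻¹ ^ 5) *
        ENNReal.ofReal (r / 3 * mass w u (Finset.range (m + 4))) := by
        rw [← ENNReal.ofReal_mul (by positivity)]
        refine ENNReal.ofReal_le_ofReal ?_
        have h3 := pow_mul_mass_le w u m 4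
        calc 2 * (2 * r) * ((minWeight w)⁻¹ * mass w u (Finset.range m))
            = 12 * (minWeight w)⁻¹ ^ 5 *
              (r / 3 * (minWeight w ^ 4 * mass w u (Finset.range m))) := by
              field_simp
              ring
          _ ≤ _ := by gcongr
    _ ≤ _ := by gcongr

theorem isDoubling_laaksoMeasure : IsDoubling (laaksoMeasure w) := by
  have hc := minWeight_pos w
  have hc1 := minWeight_lt_one w
  have hD : 1 < 12 * (minWeight w)⁻¹ ^ 5 := by
    have : 1 ≤ (minWeight w)⁻¹ ^ 5 := one_le_pow₀ ((one_le_inv₀ hc).2 hc1.le)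
    linarith
  refine ⟨fun x r hr => ⟨?_, measure_lt_top _ _⟩, (12 * (minWeight w)⁻¹ ^ 5).toNNReal,
    Real.one_lt_toNNReal.2 hD, fun x r hr => ?_⟩
  · obtain ⟨⟨t, u⟩, rfl⟩ := q_surjective x
    obtain ⟨M, hM⟩ := exists_pow_lt_of_lt_one (show 0 < r / 8 by linarith)
      (show (3 : ℝ)⁻¹ < 1 by norm_num)
    refine lt_of_lt_of_le ?_ (le_measure_ball w t u (δ := min (r / 4) (1 / 2)) (M := M)
      (by positivity) (min_le_right _ _) (by linarith [min_le_left (r / 4) (1 / 2)]))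
    have := mass_pos w u (Finset.range M)
    rw [ENNReal.ofReal_pos]
    positivity
  · have key := fun r => measure_ball_two_mul_le_of_le w x (r := r)
    change _ ≤ ENNReal.ofReal _ * _
    rcases le_total r (1 / 4) with h | h
    · exact key r hr h
    · obtain ⟨⟨t, u⟩, rfl⟩ := q_surjective x
      -- For large radii the total mass 1 suffices; `δ` and `M` are chosen so that the same constant
      -- works.
      have h2 := le_measure_ball w t u (r := r) (δ := 1 / 12) (M := 4) (by norm_num)
        (by norm_num) (by norm_num; linarith)
      have h3 := pow_mul_mass_le w u 0 4
      simp only [Finset.range_zero, mass, Finset.prod_empty, mul_one, zero_add] at h3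
      calc _ ≤ 1 := prob_le_one
        _ ≤ ENNReal.ofReal (12 * (minWeight w)⁻¹ ^ 5) *
            ENNReal.ofReal (1 / 12 * mass w u (Finset.range 4)) := by
            rw [← ENNReal.ofReal_mul (by positivity), ENNReal.one_le_ofReal]
            calc (1 : ℝ) ≤ (minWeight w)⁻¹ := (one_le_inv₀ hc).2 hc1.le
              _ = 12 * (minWeight w)⁻¹ ^ 5 * (1 / 12 * minWeight w ^ 4) := by
                field_simp
              _ ≤ _ := by
                gcongr
                exact h3
        _ ≤ _ := by gcongr

instance : IsUnifLocDoublingMeasure (laaksoMeasure w) := by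
  obtain ⟨-, D, -, hD⟩ := isDoubling_laaksoMeasure w
  refine ⟨⟨D * D, ?_⟩⟩
  filter_upwards [self_mem_nhdsWithin] with r hr x
  have hr : 0 < r := hr
  calc laaksoMeasure w (Metric.closedBall x (2 * r))
      ≤ laaksoMeasure w (Metric.ball x (2 * (2 * r))) :=
        measure_mono (Metric.closedBall_subset_ball (by linarith))
    _ ≤ D * (D * laaksoMeasure w (Metric.ball x r)) :=
        (hD x _ (by linarith)).trans (by gcongr; exact hD x r hr)
    _ ≤ _ := by
        rw [ENNReal.coe_mul, mul_assoc]
        gcongr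
        exact Metric.ball_subset_closedBall

/-! ### The law of the digits and mutual singularity -/

/-- The sequence of binary digits of a point. -/
def digits (x : Space) : ℕ → Bool := fun n => digit n x

theorem measurable_digits : Measurable digits := measurable_pi_lambda _ measurable_digit

theorem ae_notMem_wormholeHeights :
    ∀ᵐ t : unitInterval, ∀ n, (t : ℝ) ∉ wormholeHeights n := by
  refine ae_all_iff.2 fun n => ?_
  rw [ae_iff, volume_image_coe]
  refine measure_mono_null ?_ ((wormholeHeights_finite n).measure_zero _)
  rintro _ ⟨t, ht, rfl⟩
  exact not_not.1 ht

theorem ae_digits_q : ∀ᵐ z ∂((volume : Measure unitInterval).prod (cantorMeasure w)),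
    digits (q z) = addr z.2 := by
  filter_upwards [Measure.quasiMeasurePreserving_fst.ae ae_notMem_wormholeHeights] with z hz
  exact funext fun n => digit_q (hz n)

/-- Off the null set of wormhole heights the digits of `q z` are the address of the Cantor
coordinate, so their law does not see the height. -/
theorem map_digits_laaksoMeasure :
    (laaksoMeasure w).map digits = Measure.infinitePi fun _ => digitMeasure w := by
  rw [laaksoMeasure_eq, Measure.map_map measurable_digits measurable_q,
    Measure.map_congr (show digits ∘ q =ᵐ[_] (fun u : cantorSet => addr u) ∘ Prod.snd from
      ae_digits_q w),
    ← Measure.map_map measurable_addr measurable_snd, Measure.map_snd_prod, measure_univ, one_smul,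
    cantorMeasure, Measure.map_map measurable_addr measurable_pt]
  have : (fun u : cantorSet => addr u) ∘ pt = id := by
    ext s
    simp
  rw [this, Measure.map_id]

theorem ae_tendsto_frequency : ∀ᵐ s ∂(Measure.infinitePi fun _ : ℕ => digitMeasure w),
    Tendsto (fun n : ℕ => (∑ i ∈ Finset.range n, (if s i then 1 else 0 : ℝ)) / (n : ℝ)) atTop
      (𝓝 (1 - (w : ℝ))) := by
  let b : Bool → ℝ := fun a => if a then 1 else 0
  have hb : Measurable b := measurable_of_finite b
  have hmp : ∀ i, MeasurePreserving (fun s : ℕ → Bool => s i)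
      (Measure.infinitePi fun _ : ℕ => digitMeasure w) (digitMeasure w) := fun i =>
    ⟨measurable_pi_apply i, Measure.infinitePi_map_eval _ i⟩
  have hint : ∫ s, b (s 0) ∂(Measure.infinitePi fun _ : ℕ => digitMeasure w) = 1 - w := by
    rw [← integral_map (φ := fun s : ℕ → Bool => s 0) (hmp 0).measurable.aemeasurable
      hb.aestronglyMeasurable, (hmp 0).map_eq, integral_fintype Integrable.of_finite]
    simp [b, measureReal_def, digitMeasure_singleton, weight, w.2.2.le]
  have h := ProbabilityTheory.strong_law_ae_real
    (μ := Measure.infinitePi fun _ : ℕ => digitMeasure w) (fun i s => b (s i))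
    ((hmp 0).integrable_comp_of_integrable (g := b) Integrable.of_finite)
    (fun i j hij => (ProbabilityTheory.iIndepFun_infinitePi (X := fun _ => b)
      fun _ => hb).indepFun hij)
    (fun i => ⟨(hb.comp (hmp i).measurable).aemeasurable,
      (hb.comp (hmp 0).measurable).aemeasurable, by
        change Measure.map (b ∘ fun s : ℕ → Bool => s i) _ = Measure.map (b ∘ fun s : ℕ → Bool => s 0) _
        rw [← Measure.map_map hb (hmp i).measurable, ← Measure.map_map hb (hmp 0).measurable,
          (hmp i).map_eq, (hmp 0).map_eq]⟩)
  rw [hint] at h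
  exact h

/-- The frequency of the digit 1 tends to `1 - w` almost surely for one measure and to `1 - w'` for
the other; the two events are disjoint. -/
theorem mutuallySingular_laaksoMeasure {w w' : Ioo (0 : ℝ) 1} (h : w ≠ w') :
    Measure.MutuallySingular (laaksoMeasure w) (laaksoMeasure w') := by
  have key : ∀ w : Ioo (0 : ℝ) 1, ∀ᵐ x ∂(laaksoMeasure w),
      Tendsto (fun n : ℕ => (∑ i ∈ Finset.range n, (if digits x i then 1 else 0 : ℝ)) / (n : ℝ))
        atTop (𝓝 (1 - (w : ℝ))) := by
    intro w
    have h := ae_tendsto_frequency w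
    rw [← map_digits_laaksoMeasure] at h
    exact ae_of_ae_map measurable_digits.aemeasurable h
  refine Measure.MutuallySingular.mk (ae_iff.1 (key w)) (ae_iff.1 (key w')) fun x _ => ?_
  by_contra hx
  rw [mem_union, not_or] at hx
  have h1 := tendsto_nhds_unique (not_not.1 hx.1) (not_not.1 hx.2)
  exact h (Subtype.ext (by linarith))

end Measures

/-! ### Differentiability of Lipschitz functions almost everywhere. -/

section Differentiability

/-! ### Lipschitz functions along vertical lines -/

/-- The restriction of `f` to the vertical line through `u`, extended to `ℝ` by constants. -/
def line (f : Space → ℝ) (u : cantorSet) (t : ℝ) : ℝ :=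
  f (q (projIcc 0 1 zero_le_one t, u))

theorem line_coe (f : Space → ℝ) (u : cantorSet) (t : unitInterval) :
    line f u t = f (q (t, u)) := by
  rw [line, projIcc_val]

/-- The derivative of `f` in the vertical direction. -/
def slope (f : Space → ℝ) (x : Space) : ℝ := deriv (line f (pt (digits x))) (height x)

variable {f : Space → ℝ} {L : ℝ≥0}

theorem continuous_uncurry_line (hf : Continuous f) : Continuous (Function.uncurry (line f)) :=
  hf.comp (continuous_q.comp ((continuous_projIcc.comp continuous_snd).prodMk continuous_fst))

theorem lipschitzWith_line (hf : LipschitzWith L f) (u : cantorSet) :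
    LipschitzWith L (line f u) := by
  have h1 : LipschitzWith 1 fun t : unitInterval => q (t, u) :=
    LipschitzWith.of_dist_le_mul fun t t' => by
      rw [NNReal.coe_one, one_mul, dist_comm t, Subtype.dist_eq, Real.dist_eq]
      exact dist_q_vertical t t' u
  have := hf.comp (h1.comp (LipschitzWith.projIcc (zero_le_one' ℝ)))
  rwa [mul_one, mul_one] at this

theorem measurable_slope (hf : Continuous f) : Measurable (slope f) :=
  (measurable_deriv_with_param (continuous_uncurry_line hf)).comp
    ((measurable_pt.comp measurable_digits).prodMk lipschitzWith_height.continuous.measurable)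

theorem ae_slope_q (w : Ioo (0 : ℝ) 1) (f : Space → ℝ) :
    ∀ᵐ z ∂((volume : Measure unitInterval).prod (cantorMeasure w)),
      slope f (q z) = deriv (line f z.2) z.1 := by
  filter_upwards [ae_digits_q w] with z hz
  rw [slope, hz, height_q, show pt (addr z.2) = z.2 from
    cantorSetHomeomorphNatToBool.symm_apply_apply _]

theorem integrable_slope (hf : LipschitzWith L f) (w : Ioo (0 : ℝ) 1) :
    Integrable (slope f) (laaksoMeasure w) :=
  Integrable.of_bound (measurable_slope hf.continuous).aestronglyMeasurable L
    (Eventually.of_forall fun _ => norm_deriv_le_of_lipschitz (lipschitzWith_line hf _))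

/-- The fundamental theorem of calculus for absolutely continuous functions, applied to `line f u`
minus the linear function of slope `D`. -/
theorem enorm_line_sub_le (hf : LipschitzWith L f) (u : cantorSet) (D : ℝ)
    {J : Set unitInterval} (hJ : MeasurableSet J) {t₁ t₂ : unitInterval}
    (hJt : ∀ s : unitInterval, (s : ℝ) ∈ uIcc (t₁ : ℝ) t₂ → s ∈ J) :
    ‖f (q (t₂, u)) - f (q (t₁, u)) - D * (t₂ - t₁)‖ₑ ≤
      ∫⁻ s in J, ‖deriv (line f u) s - D‖ₑ := by
  have hlip := lipschitzWith_line hf u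
  have hac : AbsolutelyContinuousOnInterval (line f u) t₁ t₂ :=
    hlip.lipschitzOnWith.absolutelyContinuousOnInterval
  have hFTC := hac.integral_deriv_eq_sub
  have hii : IntervalIntegrable (deriv (line f u)) volume t₁ t₂ := hac.intervalIntegrable_deriv
  have h1 : ∫ s in (t₁ : ℝ)..t₂, (deriv (line f u) s - D) =
      f (q (t₂, u)) - f (q (t₁, u)) - D * (t₂ - t₁) := by
    rw [intervalIntegral.integral_sub hii intervalIntegrable_const, hFTC,
      intervalIntegral.integral_const, line_coe, line_coe, smul_eq_mul, mul_comm D]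
  have hsub : uIoc (t₁ : ℝ) t₂ ⊆ unitInterval := fun s hs =>
    (uIcc_subset_Icc t₁.2 t₂.2) (uIoc_subset_uIcc hs)
  calc ‖f (q (t₂, u)) - f (q (t₁, u)) - D * (t₂ - t₁)‖ₑ
      = ‖∫ s in uIoc (t₁ : ℝ) t₂, (deriv (line f u) s - D)‖ₑ := by
        rw [← h1, ← ofReal_norm, ← ofReal_norm,
          intervalIntegral.norm_integral_eq_norm_integral_uIoc]
    _ ≤ ∫⁻ s in uIoc (t₁ : ℝ) t₂, ‖deriv (line f u) s - D‖ₑ := enorm_integral_le_lintegral_enorm _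
    _ = ∫⁻ s in unitInterval, (uIoc (t₁ : ℝ) t₂).indicator
          (fun s => ‖deriv (line f u) s - D‖ₑ) s := by
        rw [setLIntegral_indicator measurableSet_uIoc, inter_eq_left.2 hsub]
    _ = ∫⁻ s : unitInterval, (uIoc (t₁ : ℝ) t₂).indicator
          (fun s => ‖deriv (line f u) s - D‖ₑ) s :=
        (lintegral_subtype_comap measurableSet_Icc _).symm
    _ ≤ ∫⁻ s : unitInterval, J.indicator (fun s => ‖deriv (line f u) s - D‖ₑ) s := by
        refine lintegral_mono fun s => ?_
        by_cases hs : (s : ℝ) ∈ uIoc (t₁ : ℝ) t₂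
        · rw [indicator_of_mem hs, indicator_of_mem (hJt s (uIoc_subset_uIcc hs))]
        · rw [indicator_of_notMem hs]
          exact zero_le
    _ = ∫⁻ s in J, ‖deriv (line f u) s - D‖ₑ := lintegral_indicator hJ _

/-- By Fubini the integral over `B` dominates the integral over `C` of the line integrals, and some
line does no worse than the average. -/
theorem exists_lintegral_line_le (hf : Continuous f) (w : Ioo (0 : ℝ) 1) (D : ℝ)
    {J : Set unitInterval} {C : Set cantorSet} {B : Set Space} (hB : MeasurableSet B)
    (hC0 : cantorMeasure w C ≠ 0) (hJC : J ×ˢ C ⊆ q ⁻¹' B) :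
    ∃ v ∈ C, ∫⁻ s in J, ‖deriv (line f v) s - D‖ₑ ≤
      (∫⁻ y in B, ‖slope f y - D‖ₑ ∂(laaksoMeasure w)) / cantorMeasure w C := by
  have hmeas : Measurable fun z : Strip => ‖deriv (line f z.2) z.1 - D‖ₑ :=
    (((measurable_deriv_with_param (continuous_uncurry_line hf)).comp
      (measurable_snd.prodMk (measurable_subtype_coe.comp measurable_fst))).sub_const D).enorm
  have hle : ∫⁻ v in C, (∫⁻ s in J, ‖deriv (line f v) s - D‖ₑ) ∂(cantorMeasure w) ≤
      ∫⁻ y in B, ‖slope f y - D‖ₑ ∂(laaksoMeasure w) := by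
    rw [laaksoMeasure_eq, setLIntegral_map hB
      ((measurable_slope hf).sub_const D).enorm measurable_q]
    calc ∫⁻ v in C, (∫⁻ s in J, ‖deriv (line f v) s - D‖ₑ) ∂(cantorMeasure w)
        = ∫⁻ z in J ×ˢ C, ‖deriv (line f z.2) z.1 - D‖ₑ
          ∂((volume : Measure unitInterval).prod (cantorMeasure w)) := by
          rw [← Measure.prod_restrict, lintegral_prod_symm _ hmeas.aemeasurable]
      _ ≤ ∫⁻ z in q ⁻¹' B, ‖deriv (line f z.2) z.1 - D‖ₑ
          ∂((volume : Measure unitInterval).prod (cantorMeasure w)) := lintegral_mono_set hJC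
      _ = _ := lintegral_congr_ae (ae_restrict_of_ae (by
          filter_upwards [ae_slope_q w f] with z hz
          rw [hz]))
  obtain ⟨v, hv, hv'⟩ := exists_le_setLAverage hC0 (measure_ne_top _ _)
    (hmeas.lintegral_prod_left' (μ := volume.restrict J)).aemeasurable
  refine ⟨v, hv, hv'.trans ?_⟩
  rw [setLAverage_eq]
  gcongr

/-! ### Differentiability of Lipschitz functions -/

theorem q_eq_of_eqOn {h : unitInterval} {k : ℕ} (hk : (h : ℝ) ∈ wormholeHeights k)
    {u v : cantorSet} (huv : ∀ i, i ≠ k → addr u i = addr v i) : q (h, u) = q (h, v) := by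
  have h1 := mk_eq_of_eqOn hk huv
  simp only [Homeomorph.symm_apply_apply] at h1
  exact h1

/-- The distance of points whose first `m` digits agree with at most one exception, for which
there is a wormhole level `h` to pass through. -/
theorem dist_q_le_of_level {t t' h : unitInterval} {u v : cantorSet} {k m : ℕ}
    (hk : (h : ℝ) ∈ wormholeHeights k) (huv : ∀ i < m, i ≠ k → addr u i = addr v i) :
    dist (q (t, u)) (q (t', v)) ≤ |(h : ℝ) - t| + (|(t' : ℝ) - h| + 4 * (3 : ℝ)⁻¹ ^ m) := by
  let v' : cantorSet := pt (Function.update (addr u) k (addr v k))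
  have hv' : addr v' = Function.update (addr u) k (addr v k) :=
    cantorSetHomeomorphNatToBool.apply_symm_apply _
  have h1 : q (h, u) = q (h, v') := q_eq_of_eqOn hk fun i hi => by
    rw [hv', Function.update_of_ne hi]
  refine (dist_triangle _ (q (h, u)) _).trans (add_le_add (dist_q_vertical _ _ _) ?_)
  rw [h1]
  refine dist_q_le fun i hi => ?_
  rw [hv']
  by_cases hik : i = k
  · rw [hik, Function.update_self]
  · rw [Function.update_of_ne hik, huv i hi hik]

/-- If the vertical derivative of `f` is close to `D` on average over the columns `J × C`, where
`C` is a cylinder of generation `M`, then `f - D h` is almost constant on vertical segments. -/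
theorem abs_sub_le_of_column (hf : LipschitzWith L f) (w : Ioo (0 : ℝ) 1) (D : ℝ)
    {J : Set unitInterval} (hJ : MeasurableSet J) {v : cantorSet} {M : ℕ} {B : Set Space}
    (hB : MeasurableSet B) (hJB : J ×ˢ cylinder v (Finset.range M) ⊆ q ⁻¹' B) {A κ : ℝ}
    (hA0 : 0 ≤ A)
    (hA : κ ≤ A * mass w v (Finset.range M))
    (hκ : ∫⁻ y in B, ‖slope f y - D‖ₑ ∂(laaksoMeasure w) ≤ ENNReal.ofReal κ)
    {t₁ t₂ : unitInterval}
    (hJt : ∀ s : unitInterval, (s : ℝ) ∈ uIcc (t₁ : ℝ) t₂ → s ∈ J) :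
    |f (q (t₂, v)) - f (q (t₁, v)) - D * (t₂ - t₁)| ≤ A + 8 * L * (3 : ℝ)⁻¹ ^ M := by
  have hmass := mass_pos w v (Finset.range M)
  have hν := cantorMeasure_cylinder w v (Finset.range M)
  -- Averaging controls some `v'` in the cylinder, not `v` itself; passing from `v'` to `v` at both
  -- endpoints costs the term with `8 * L`.
  obtain ⟨v', hv', hint⟩ := exists_lintegral_line_le hf.continuous w D hB
    (by rw [hν]; exact (ENNReal.ofReal_pos.2 hmass).ne') hJB
  have h1 : |f (q (t₂, v')) - f (q (t₁, v')) - D * (t₂ - t₁)| ≤ A := by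
    have h2 := (enorm_line_sub_le hf v' D hJ hJt).trans hint
    have h3 : (∫⁻ y in B, ‖slope f y - D‖ₑ ∂(laaksoMeasure w)) /
        cantorMeasure w (cylinder v (Finset.range M)) ≤ ENNReal.ofReal A := by
      rw [hν]
      refine ENNReal.div_le_of_le_mul (hκ.trans ?_)
      rw [← ENNReal.ofReal_mul hA0]
      exact ENNReal.ofReal_le_ofReal hA
    have h4 := h2.trans h3
    rwa [← ofReal_norm, ENNReal.ofReal_le_ofReal_iff hA0, Real.norm_eq_abs] at h4
  have hclose : ∀ t : unitInterval,
      |f (q (t, v')) - f (q (t, v))| ≤ L * (4 * (3 : ℝ)⁻¹ ^ M) := by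
    intro t
    refine (hf.dist_le_mul _ _).trans ?_
    gcongr
    exact dist_q_le_of_eqOn t fun k hk => hv' k (Finset.mem_range.2 hk)
  have h5 := hclose t₁
  have h6 := hclose t₂
  rw [abs_le] at h1 h5 h6 ⊢
  constructor <;> linarith

/-- The oscillation of `f - D h` on a ball, given that the slope of `f` is close to `D` on average
over a larger ball. -/
theorem abs_sub_le_of_average_le (hf : LipschitzWith L f) (w : Ioo (0 : ℝ) 1) (D : ℝ)
    {x : Space} {r ε : ℝ} (hr0 : 0 < r) (hr : r ≤ 1 / 162) (hε : 0 ≤ ε)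
    (hint : ∫⁻ y in Metric.closedBall x (32 * r), ‖slope f y - D‖ₑ ∂(laaksoMeasure w) ≤
      ENNReal.ofReal ε * laaksoMeasure w (Metric.closedBall x (32 * r))) (N : ℕ)
    {y : Space} (hy : dist x y < r) :
    |f y - f x - D * (height y - height x)| ≤
      (2 * N + 4) * (66 * ε * (minWeight w)⁻¹ ^ (N + 6) + 48 * L * (3 : ℝ)⁻¹ ^ N) * r := by
  obtain ⟨⟨t, u⟩, rfl⟩ := q_surjective x
  obtain ⟨⟨t', u'⟩, rfl⟩ := q_surjective y
  have hc := minWeight_pos w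
  have hL : (0 : ℝ) ≤ L := L.2
  -- Two scales: `m₁` is coarse enough to bound the mass of the ball of radius `33 * r`, while `m =
  -- m₁ + 4` satisfies `2 * r ≤ 3⁻¹ ^ m < 6 * r`.
  obtain ⟨m₁, hm1, hm2⟩ := exists_nat_pow_near_of_lt_one (show 0 < 162 * r by linarith)
    (by linarith) (by norm_num : (0 : ℝ) < 3⁻¹) (by norm_num)
  let m := m₁ + 4
  let M := m + N
  have hm_low : 2 * r ≤ (3 : ℝ)⁻¹ ^ m := by
    simp only [m, pow_add]
    norm_num at hm2 ⊢
    linarith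
  have hm_up : (3 : ℝ)⁻¹ ^ m < 6 * r := by
    rw [pow_succ] at hm1
    simp only [m, pow_add]
    norm_num at hm1 ⊢
    linarith
  have hM_up : (3 : ℝ)⁻¹ ^ M ≤ 6 * r * (3 : ℝ)⁻¹ ^ N := by
    simp only [M, pow_add]
    gcongr
  obtain ⟨k₀, hk₀⟩ := exists_unique_order (t : ℝ) hm_low
  have hlevel : ∀ k, addr u k ≠ addr u' k → ∃ h : unitInterval,
      (h : ℝ) ∈ wormholeHeights k ∧ |(h : ℝ) - t| < r := by
    intro k hk
    obtain ⟨a, ha, har⟩ := exists_mem_of_dist_lt hy hk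
    exact ⟨⟨a, mem_unitInterval_of_mem ha⟩, ha, har⟩
  have hne : ∀ k < m, addr u k ≠ addr u' k → k = k₀ := fun k hk hk' =>
    hk₀ k hk (exists_mem_of_dist_lt hy hk')
  have htt' : |(t' : ℝ) - t| < r := (abs_sub_le_dist (t, u) (t', u')).trans_lt hy
  let J : Set unitInterval := {s | |(s : ℝ) - t| ≤ r}
  have hJ : MeasurableSet J := measurableSet_le (by fun_prop) measurable_const
  have hJt : ∀ t₁ ∈ J, ∀ t₂ ∈ J, ∀ s : unitInterval, (s : ℝ) ∈ uIcc (t₁ : ℝ) t₂ → s ∈ J := by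
    intro t₁ h₁ t₂ h₂ s hs
    simp only [J, mem_ofPred_eq, abs_le] at h₁ h₂ ⊢
    rcases mem_uIcc.1 hs with hs | hs <;> constructor <;> linarith [hs.1, hs.2]
  -- Among the first `m` digits only `k₀` may differ from those of `u`, and then a level within `r`
  -- of `t` serves to change it: the distance is at most `r + 2 * r + 24 * r`.
  have hcol : ∀ v : cantorSet, (∀ k, addr v k = addr u k ∨ addr v k = addr u' k) →
      J ×ˢ cylinder v (Finset.range M) ⊆ q ⁻¹' Metric.closedBall (q (t, u)) (32 * r) := by
    rintro v hv ⟨s, v'⟩ ⟨hs, hv'⟩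
    have hs : |(s : ℝ) - t| ≤ r := hs
    have hv'' : ∀ k < m, addr v' k = addr v k := fun k hk =>
      hv' k (Finset.mem_range.2 (hk.trans_le (Nat.le_add_right _ _)))
    have hoff : ∀ k < m, k ≠ k₀ → addr u k = addr v' k := by
      intro k hk hkk
      by_contra hcon
      rw [hv'' k hk] at hcon
      have h1 := (hv k).resolve_left (Ne.symm hcon)
      exact hkk (hne k hk (h1 ▸ hcon))
    rw [mem_preimage, Metric.mem_closedBall, dist_comm]
    by_cases hex : ∃ k < m, addr u k ≠ addr v' k
    · obtain ⟨k, hk, hcon⟩ := hex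
      have hkk : k = k₀ := by
        by_contra h
        exact hcon (hoff k hk h)
      rw [hv'' k hk] at hcon
      have h1 := (hv k).resolve_left (Ne.symm hcon)
      obtain ⟨h, hh, hhr⟩ := hlevel k (h1 ▸ hcon)
      refine (dist_q_le_of_level hh fun i hi hik => hoff i hi (hkk ▸ hik)).trans ?_
      have h2 : |(s : ℝ) - h| ≤ |(s : ℝ) - t| + |(t : ℝ) - h| := abs_sub_le _ _ _
      rw [abs_sub_comm (t : ℝ) h] at h2
      linarith
    · push Not at hex
      refine (dist_q_le hex).trans ?_
      linarith
  -- The exponent counts `N` digits beyond `m`, the exceptional digit `k₀`, and four digits between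
  -- `m₁` and `m`.
  have hmass : ∀ v : cantorSet, (∀ k, addr v k = addr u k ∨ addr v k = addr u' k) →
      minWeight w ^ (N + 5) * mass w u (Finset.range m₁) ≤ mass w v (Finset.range M) := by
    intro v hv
    have h1 : mass w v ((Finset.range m).erase k₀) = mass w u ((Finset.range m).erase k₀) := by
      refine mass_congr w fun k hk => ?_
      rw [Finset.mem_erase, Finset.mem_range] at hk
      by_contra hcon
      have h1 := (hv k).resolve_left hcon
      exact hk.1 (hne k hk.2 (h1 ▸ Ne.symm hcon))
    calc minWeight w ^ (N + 5) * mass w u (Finset.range m₁)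
        = minWeight w ^ N * (minWeight w * (minWeight w ^ 4 * mass w u (Finset.range m₁))) := by
          ring
      _ ≤ minWeight w ^ N * (minWeight w * mass w v ((Finset.range m).erase k₀)) := by
          rw [h1]
          gcongr
          exact (pow_mul_mass_le w u m₁ 4).trans (mass_le_mass_erase w u _ _)
      _ ≤ minWeight w ^ N * mass w v (Finset.range m) := by
          gcongr
          exact minWeight_mul_mass_erase_le w v _ _
      _ ≤ _ := pow_mul_mass_le w v m N
  have hκ : ∫⁻ y in Metric.closedBall (q (t, u)) (32 * r),
      ‖slope f y - D‖ₑ ∂(laaksoMeasure w) ≤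
      ENNReal.ofReal (ε * (66 * r * ((minWeight w)⁻¹ * mass w u (Finset.range m₁)))) := by
    refine hint.trans ?_
    rw [ENNReal.ofReal_mul hε]
    gcongr
    refine (measure_mono (Metric.closedBall_subset_ball (by linarith : 32 * r < 33 * r))).trans ?_
    refine (measure_ball_le w t u (m := m₁) (by linarith) (by linarith)).trans (le_of_eq ?_)
    congr 1
    ring
  let A := 66 * ε * (minWeight w)⁻¹ ^ (N + 6) * r
  have hA0 : 0 ≤ A := by positivity
  let δ := A + 8 * L * (3 : ℝ)⁻¹ ^ M
  have hδ0 : 0 ≤ δ := by positivity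
  let G : unitInterval → cantorSet → ℝ := fun s v => f (q (s, v)) - D * s
  have hvert : ∀ v : cantorSet, (∀ k, addr v k = addr u k ∨ addr v k = addr u' k) →
      ∀ t₁ ∈ J, ∀ t₂ ∈ J, |G t₂ v - G t₁ v| ≤ δ := by
    intro v hv t₁ h₁ t₂ h₂
    have h := abs_sub_le_of_column hf w D hJ measurableSet_closedBall (hcol v hv) (A := A) hA0
      (by
        calc ε * (66 * r * ((minWeight w)⁻¹ * mass w u (Finset.range m₁)))
            = A * (minWeight w ^ (N + 5) * mass w u (Finset.range m₁)) := by
              simp only [A, inv_pow, pow_succ]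
              field_simp
          _ ≤ _ := by
              gcongr
              exact hmass v hv) hκ (hJt t₁ h₁ t₂ h₂)
    have heq : G t₂ v - G t₁ v = f (q (t₂, v)) - f (q (t₁, v)) - D * (t₂ - t₁) := by
      simp only [G]
      ring
    rw [heq]
    exact h
  -- Hybrid addresses: `a k` has the first `k` digits of `u'`, so consecutive ones differ in at most
  -- the digit `k`.
  let a : ℕ → cantorSet := fun k => pt fun i => if i < k then addr u' i else addr u i
  have ha : ∀ k i, addr (a k) i = if i < k then addr u' i else addr u i := fun k i =>
    congrFun (cantorSetHomeomorphNatToBool.apply_symm_apply _) i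
  have ha' : ∀ k i, addr (a k) i = addr u i ∨ addr (a k) i = addr u' i := by
    intro k i
    rw [ha]
    split_ifs <;> simp
  have ha0 : a 0 = u := by
    simp only [a, Nat.not_lt_zero, if_false]
    exact cantorSetHomeomorphNatToBool.symm_apply_apply _
  have htJ : t ∈ J := by
    change |(t : ℝ) - t| ≤ r
    rw [sub_self, abs_zero]
    exact hr0.le
  -- From height `t` go along `a k` to the level `h`, where the two lines meet, and return along `a
  -- (k + 1)`: two vertical moves, each costing `δ`.
  have hstep : ∀ k, |G t (a (k + 1)) - G t (a k)| ≤
      if addr u k ≠ addr u' k then 2 * δ else 0 := by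
    intro k
    have hoff : ∀ i, i ≠ k → addr (a k) i = addr (a (k + 1)) i := by
      intro i hi
      rw [ha, ha]
      have : i < k ↔ i < k + 1 := by omega
      simp only [this]
    split_ifs with hk
    · obtain ⟨h, hh, hhr⟩ := hlevel k hk
      have h1 := hvert (a k) (ha' k) h hhr.le t htJ
      have h2 := hvert (a (k + 1)) (ha' (k + 1)) h hhr.le t htJ
      have h3 : G h (a k) = G h (a (k + 1)) := by
        simp only [G, q_eq_of_eqOn hh hoff]
      rw [h3] at h1
      rw [abs_le] at h1 h2 ⊢
      constructor <;> linarith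
    · have : a (k + 1) = a k := by
        refine cantorSetHomeomorphNatToBool.injective (funext fun i => ?_)
        change addr _ i = addr _ i
        by_cases hi : i = k
        · rw [ha, ha, hi]
          simp only [lt_add_iff_pos_right, zero_lt_one, if_true, lt_irrefl, if_false]
          exact (not_not.1 hk).symm
        · exact (hoff i hi).symm
      rw [this, sub_self, abs_zero]
  have hcard : ((Finset.range M).filter fun k => addr u k ≠ addr u' k).card ≤ N + 1 := by
    have hsub : ((Finset.range M).filter fun k => addr u k ≠ addr u' k) ⊆
        insert k₀ (Finset.Ico m M) := by
      intro k hk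
      rw [Finset.mem_filter, Finset.mem_range] at hk
      rw [Finset.mem_insert, Finset.mem_Ico]
      by_cases hkm : k < m
      · exact Or.inl (hne k hkm hk.2)
      · exact Or.inr ⟨not_lt.1 hkm, hk.1⟩
    refine (Finset.card_le_card hsub).trans ((Finset.card_insert_le _ _).trans ?_)
    rw [Nat.card_Ico]
    omega
  have hchain : |G t (a M) - G t u| ≤ (N + 1) * (2 * δ) := by
    have hsum := Finset.sum_range_sub (fun k => G t (a k)) M
    simp only [ha0] at hsum
    rw [← hsum]
    calc _ ≤ ∑ k ∈ Finset.range M, |G t (a (k + 1)) - G t (a k)| :=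
          Finset.abs_sum_le_sum_abs _ _
      _ ≤ ∑ k ∈ Finset.range M, if addr u k ≠ addr u' k then 2 * δ else 0 :=
          Finset.sum_le_sum fun k _ => hstep k
      _ = ((Finset.range M).filter fun k => addr u k ≠ addr u' k).card * (2 * δ) := by
          rw [← Finset.sum_filter, Finset.sum_const, nsmul_eq_mul]
      _ ≤ _ := by
          gcongr
          exact_mod_cast hcard
  have hlast : |G t' (a M) - G t (a M)| ≤ δ := hvert (a M) (ha' M) t htJ t' htt'.le
  have hend : |G t' u' - G t' (a M)| ≤ δ := by
    have h1 : G t' u' - G t' (a M) = f (q (t', u')) - f (q (t', a M)) := by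
      simp only [G]
      ring
    rw [h1]
    have h2 : dist (q (t', u')) (q (t', a M)) ≤ 4 * (3 : ℝ)⁻¹ ^ M :=
      dist_q_le_of_eqOn t' fun k hk => by rw [ha, if_pos hk]
    calc |f (q (t', u')) - f (q (t', a M))| ≤ L * dist (q (t', u')) (q (t', a M)) :=
          hf.dist_le_mul _ _
      _ ≤ L * (4 * (3 : ℝ)⁻¹ ^ M) := by gcongr
      _ ≤ δ := by
          have : 0 ≤ L * (3 : ℝ)⁻¹ ^ M := by positivity
          simp only [δ]
          linarith
  -- The `N + 1` switches cost `2 * δ` each; the move from `t` to `t'` and the correction of the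
  -- digits beyond `M` cost `δ` each.
  have htotal : |f (q (t', u')) - f (q (t, u)) - D * (height (q (t', u')) - height (q (t, u)))| ≤
      (2 * N + 4) * δ := by
    have heq : f (q (t', u')) - f (q (t, u)) - D * (height (q (t', u')) - height (q (t, u))) =
        G t' u' - G t u := by
      simp only [G, height_q]
      ring
    rw [heq]
    rw [abs_le] at hchain hlast hend ⊢
    constructor <;> linarith
  refine htotal.trans ?_
  rw [mul_assoc]
  gcongr
  simp only [δ, A]
  have : 8 * L * (3 : ℝ)⁻¹ ^ M ≤ 8 * L * (6 * r * (3 : ℝ)⁻¹ ^ N) := by gcongr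
  linarith

theorem lintegral_le_of_average_le {m : Measure Space} [IsFiniteMeasure m] {g : Space → ℝ}
    (hg : Integrable g m) {D ε : ℝ} {B : Set Space} (hB : m B ≠ 0)
    (h : ⨍ y in B, ‖g y - D‖ ∂m ≤ ε) :
    ∫⁻ y in B, ‖g y - D‖ₑ ∂m ≤ ENNReal.ofReal ε * m B := by
  have hpos : 0 < m.real B := ENNReal.toReal_pos hB (measure_ne_top _ _)
  have hint : Integrable (fun y => g y - D) (m.restrict B) :=
    (hg.sub (integrable_const D)).integrableOn
  rw [setAverage_eq, smul_eq_mul, inv_mul_le_iff₀ hpos] at h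
  rw [← ofReal_integral_norm_eq_lintegral_enorm hint]
  calc ENNReal.ofReal (∫ y in B, ‖g y - D‖ ∂m) ≤ ENNReal.ofReal (m.real B * ε) :=
        ENNReal.ofReal_le_ofReal h
    _ = ENNReal.ofReal ε * m B := by
        rw [ENNReal.ofReal_mul hpos.le, ofReal_measureReal (measure_ne_top _ _), mul_comm]

/-- Lebesgue's differentiation theorem for doubling measures supplies the small averages that
`abs_sub_le_of_average_le` requires, with `D = slope f x`. -/
theorem ae_differentiableAtPoint (hf : LipschitzWith L f) (w : Ioo (0 : ℝ) 1) :
    ∀ᵐ x ∂(laaksoMeasure w), DifferentiableAtPoint f x := by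
  have hslope := integrable_slope hf w
  filter_upwards [IsUnifLocDoublingMeasure.ae_tendsto_average_norm_sub (laaksoMeasure w)
    hslope.locallyIntegrable 1] with x hx
  have hx : Tendsto (fun R => ⨍ y in Metric.closedBall x R, ‖slope f y - slope f x‖
      ∂(laaksoMeasure w)) (𝓝[>] 0) (𝓝 0) := by
    refine hx (fun _ : ℝ => x) id tendsto_id ?_
    filter_upwards [self_mem_nhdsWithin] with R hR
    refine Metric.mem_closedBall_self ?_
    rw [one_mul]
    exact le_of_lt hR
  refine ⟨slope f x, Metric.tendsto_nhds.2 fun η hη => ?_⟩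
  have hN : Tendsto (fun N : ℕ => (2 * (N : ℝ) + 4) * (48 * L * (3 : ℝ)⁻¹ ^ N)) atTop (𝓝 0) := by
    have h1 := tendsto_self_mul_const_pow_of_lt_one (r := (3 : ℝ)⁻¹) (by norm_num) (by norm_num)
    have h2 := tendsto_pow_atTop_nhds_zero_of_lt_one (r := (3 : ℝ)⁻¹) (by norm_num) (by norm_num)
    have h3 := (h1.const_mul (96 * (L : ℝ))).add (h2.const_mul (192 * (L : ℝ)))
    simp only [mul_zero, add_zero] at h3
    refine h3.congr fun N => ?_
    ring
  -- `N` is fixed by the Lipschitz error alone; `ε` is then taken small against `K`, which grows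
  -- with `N`.
  obtain ⟨N, hN⟩ := (hN.eventually (gt_mem_nhds (show 0 < η / 4 by linarith))).exists
  have hc := minWeight_pos w
  let K : ℝ := (2 * (N : ℝ) + 4) * (66 * (minWeight w)⁻¹ ^ (N + 6))
  have hK : 0 < K := by positivity
  let ε : ℝ := η / (8 * K)
  have hε : 0 < ε := by positivity
  have hKε : K * ε = η / 8 := by
    simp only [ε]
    field_simp
  have hev := hx.eventually (gt_mem_nhds hε)
  rw [eventually_nhdsWithin_iff, Metric.eventually_nhds_iff] at hev
  obtain ⟨ρ, hρ, hev⟩ := hev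
  have hball : ∀ᶠ y in 𝓝[≠] x, dist y x < min (ρ / 64) (1 / 324) :=
    mem_nhdsWithin_of_mem_nhds (Metric.ball_mem_nhds x (by positivity))
  filter_upwards [hball, self_mem_nhdsWithin] with y hy hyx
  have hd : 0 < dist y x := dist_pos.2 hyx
  have hd1 : dist y x < ρ / 64 := hy.trans_le (min_le_left _ _)
  have hd2 : dist y x < 1 / 324 := hy.trans_le (min_le_right _ _)
  have hR : 0 < 32 * (2 * dist y x) := by positivity
  have havg := hev (y := 32 * (2 * dist y x)) (by
    rw [Real.dist_eq, sub_zero, abs_of_pos hR]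
    linarith) hR
  have hB : laaksoMeasure w (Metric.closedBall x (32 * (2 * dist y x))) ≠ 0 :=
    (((isDoubling_laaksoMeasure w).1 x _ hR).1.trans_le
      (measure_mono Metric.ball_subset_closedBall)).ne'
  -- The radius is doubled because the estimate needs `dist x y < r`; the error is then below `(η /
  -- 8 + η / 4) * 2 < η` times the distance.
  have key := abs_sub_le_of_average_le hf w (slope f x) (r := 2 * dist y x) (by linarith)
    (by linarith) hε.le (lintegral_le_of_average_le hslope hB havg.le) N (y := y)
    (by rw [dist_comm x y]; linarith)
  rw [dist_zero_right, norm_div, Real.norm_eq_abs, Real.norm_eq_abs, abs_of_pos hd,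
    div_lt_iff₀ hd]
  refine key.trans_lt ?_
  have hfac : (2 * (N : ℝ) + 4) * (66 * ε * (minWeight w)⁻¹ ^ (N + 6) + 48 * L * (3 : ℝ)⁻¹ ^ N) =
      K * ε + (2 * (N : ℝ) + 4) * (48 * L * (3 : ℝ)⁻¹ ^ N) := by
    simp only [K]
    ring
  rw [hfac, hKε]
  nlinarith

end Differentiability

end Laakso

end

theorem theorem1p1 :
    (∀ w : Set.Ioo (0 : ℝ) 1, Laakso.IsDoubling (Laakso.laaksoMeasure w)) ∧
    (∀ w w' : Set.Ioo (0 : ℝ) 1, w ≠ w' →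
      Measure.MutuallySingular (Laakso.laaksoMeasure w) (Laakso.laaksoMeasure w')) ∧
    (∀ (w : Set.Ioo (0 : ℝ) 1) (f : Laakso.Space → ℝ), (∃ L : ℝ≥0, LipschitzWith L f) →
      ∀ᵐ x ∂(Laakso.laaksoMeasure w), Laakso.DifferentiableAtPoint f x) :=
  ⟨Laakso.isDoubling_laaksoMeasure, fun _ _ h => Laakso.mutuallySingular_laaksoMeasure h,
    fun w _ ⟨_, hf⟩ => Laakso.ae_differentiableAtPoint hf w⟩
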